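/- Let $m\ge 2$ and let $\bar M=SU_{2,m}/S(U_2U_m)$ be the complex hyperbolic two-plane Grassmannian. Write $\mathfrak{su}_{2,m}=\mathfrak k\oplus\mathfrak p$ for the Cartan decomposition and identify $T_o\bar M$ with $\mathfrak p=\left\{\begin{pmatrix}0&X\\ X^*&0\end{pmatrix}: X\in M_{2,m}(\mathbb C)\right\}$. Equip $\bar M$ with the $SU_{2,m}$-invariant Riemannian metric $g$ normalized so that its minimal sectional curvature is $-4$, that is, $g(X,Y)=\mathrm{Re}\,\mathrm{tr}(XY^*)$ on $\mathfrak p$; with the invariant Kähler structure $J$ given on $\mathfrak p$ by $X\mapsto iX$; and with the invariant quaternionic Kähler structure $\mathfrak J$ given on $\mathfrak p$ by the maps $X\mapsto qX$, $q\in\mathfrak{su}_2$. A canonical local basis of $\mathfrak J$ consists of almost Hermitian structures $J_1,J_2,J_3\in\mathfrak J$ with $J_\nu J_{\nu+1}=J_{\nu+2}=-J_{\nu+1}J_\nu$ (indices modulo $3$). Let $M$ be a connected orientable (immersed, smooth) real hypersurface of $\bar M$ with unit normal vector field $N$, induced metric $g$, Levi-Civita connection $\nabla$ of $(M,g)$,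 and shape operator $AX=-\bar\nabla_XN$, where $\bar\nabla$ is the Levi-Civita connection of $\bar M$. For $X$ tangent to $M$ write $JX=\phi X+\eta(X)N$ and $J_\nu X=\phi_\nu X+\eta_\nu(X)N$, with $\phi X$ and $\phi_\nu X$ tangent to $M$, and let $\xi=-JN$ be the Reeb vector field. Suppose that the Reeb flow is geodesic, that is, $\nabla_\xi\xi=0$. Then there is a smooth function $\alpha$ on $M$ with $A\xi=\alpha\xi$, and for every point $x\in M$, every canonical local basis $J_1,J_2,J_3$ of $\mathfrak J$ near the image of $x$ in $\bar M$, and all $X,Y\in T_xM$, $$ \begin{aligned} 2g(A\phi AX,Y)&-\alpha\, g((A\phi+\phi A)X,Y)+g(\phi X,Y)\\ &=\sum_{\nu=1}^3\big\{\eta_\nu(X)\eta_\nu(\phi Y)-\eta_\nu(Y)\eta_\nu(\phi X)-g(\phi_\nu X,Y)\eta_\nu(\xi)\\ &\qquad\quad-2\eta(X)\eta_\nu(\phi Y)\eta_\nu(\xi)+2\eta(Y)\eta_\nu(\phi X)\eta_\nu(\xi)\big\}. \end{aligned} $$ -/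

import Mathlib

open scoped Manifold ContDiff Matrix ComplexOrder

noncomputable section

namespace HyperbolicGrassmannian

/-! ### The homogeneous space `SU(2,m) / S(U(2)U(m))` -/

/-- The matrix `I_{2,m} = diag(-I₂, I_m)`. -/
def signature (m : ℕ) : Matrix (Fin 2 ⊕ Fin m) (Fin 2 ⊕ Fin m) ℂ :=
  Matrix.fromBlocks (-1) 0 0 1

/-- The indefinite special unitary group `SU(2,m)`. -/
def SU (m : ℕ) : Subgroup (Matrix.SpecialLinearGroup (Fin 2 ⊕ Fin m) ℂ) where
  carrier := {g | (g.1)ᴴ * signature m * g.1 = signature m}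
  one_mem' := by simp
  mul_mem' := by
    intro a b ha hb
    simp only [Set.mem_ofPred_eq] at ha hb ⊢
    calc ((a * b).1)ᴴ * signature m * (a * b).1
        = (b.1)ᴴ * ((a.1)ᴴ * signature m * a.1) * b.1 := by
          simp [Matrix.conjTranspose_mul, Matrix.mul_assoc]
      _ = signature m := by rw [ha, hb]
  inv_mem' := by
    intro a ha
    simp only [Set.mem_ofPred_eq] at ha ⊢
    have h : a.1 * (a⁻¹).1 = 1 := congrArg Subtype.val (mul_inv_cancel a)
    have h' : ((a⁻¹).1)ᴴ * (a.1)ᴴ = 1 := by rw [← Matrix.conjTranspose_mul, h]; simp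
    calc ((a⁻¹).1)ᴴ * signature m * (a⁻¹).1
        = ((a⁻¹).1)ᴴ * ((a.1)ᴴ * signature m * a.1) * (a⁻¹).1 := by rw [ha]
      _ = (((a⁻¹).1)ᴴ * (a.1)ᴴ) * signature m * (a.1 * (a⁻¹).1) := by
          simp only [Matrix.mul_assoc]
      _ = signature m := by rw [h, h']; simp

/-- The four blocks of `g ∈ SU(2,m)`. -/
def blockA {m : ℕ} (g : SU m) : Matrix (Fin 2) (Fin 2) ℂ := g.1.1.toBlocks₁₁
def blockB {m : ℕ} (g : SU m) : Matrix (Fin 2) (Fin m) ℂ := g.1.1.toBlocks₁₂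
def blockC {m : ℕ} (g : SU m) : Matrix (Fin m) (Fin 2) ℂ := g.1.1.toBlocks₂₁
def blockD {m : ℕ} (g : SU m) : Matrix (Fin m) (Fin m) ℂ := g.1.1.toBlocks₂₂

lemma coe_eq_fromBlocks {m : ℕ} (g : SU m) :
    g.1.1 = Matrix.fromBlocks (blockA g) (blockB g) (blockC g) (blockD g) :=
  (Matrix.fromBlocks_toBlocks _).symm

lemma blocks_mul {m : ℕ} (g h : SU m) :
    blockA (g * h) = blockA g * blockA h + blockB g * blockC h ∧
    blockB (g * h) = blockA g * blockB h + blockB g * blockD h ∧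
    blockC (g * h) = blockC g * blockA h + blockD g * blockC h ∧
    blockD (g * h) = blockC g * blockB h + blockD g * blockD h := by
  have h1 : (g * h).1.1 = g.1.1 * h.1.1 := rfl
  rw [coe_eq_fromBlocks, coe_eq_fromBlocks g, coe_eq_fromBlocks h,
    Matrix.fromBlocks_multiply, Matrix.fromBlocks_inj] at h1
  exact h1

lemma blocks_unitary {m : ℕ} (g : SU m) :
    (blockA g)ᴴ * blockA g = 1 + (blockC g)ᴴ * blockC g ∧
    (blockA g)ᴴ * blockB g = (blockC g)ᴴ * blockD g ∧
    (blockD g)ᴴ * blockD g = 1 + (blockB g)ᴴ * blockB g := by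
  have h := g.2
  change (g.1.1)ᴴ * signature m * g.1.1 = signature m at h
  rw [coe_eq_fromBlocks g, signature, Matrix.fromBlocks_conjTranspose,
    Matrix.fromBlocks_multiply, Matrix.fromBlocks_multiply, Matrix.fromBlocks_inj] at h
  obtain ⟨h1, h2, _, h4⟩ := h
  simp only [Matrix.mul_neg, Matrix.mul_one, Matrix.mul_zero, add_zero, zero_add,
    Matrix.neg_mul] at h1 h2 h4
  refine ⟨?_, ?_, ?_⟩
  · rw [neg_add_eq_iff_eq_add] at h1
    rw [h1]; abel_nf
  · exact (neg_add_eq_zero.mp h2)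
  · rw [neg_add_eq_iff_eq_add] at h4
    rw [h4, add_comm]

lemma isUnit_blockD {m : ℕ} (g : SU m) : IsUnit (blockD g) := by
  have h : ((1 : Matrix (Fin m) (Fin m) ℂ) + (blockB g)ᴴ * blockB g).PosDef :=
    Matrix.PosDef.one.add_posSemidef (Matrix.posSemidef_conjTranspose_mul_self _)
  rw [← (blocks_unitary g).2.2] at h
  have h' := (Matrix.isUnit_iff_isUnit_det _).1 h.isUnit
  rw [Matrix.det_mul] at h'
  exact (Matrix.isUnit_iff_isUnit_det _).2 (isUnit_of_mul_isUnit_right h')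

lemma isUnit_blockA {m : ℕ} (g : SU m) : IsUnit (blockA g) := by
  have h : ((1 : Matrix (Fin 2) (Fin 2) ℂ) + (blockC g)ᴴ * blockC g).PosDef :=
    Matrix.PosDef.one.add_posSemidef (Matrix.posSemidef_conjTranspose_mul_self _)
  rw [← (blocks_unitary g).1] at h
  have h' := (Matrix.isUnit_iff_isUnit_det _).1 h.isUnit
  rw [Matrix.det_mul] at h'
  exact (Matrix.isUnit_iff_isUnit_det _).2 (isUnit_of_mul_isUnit_right h')

/-- The isotropy group `S(U(2)U(m))`: the block diagonal elements of `SU(2,m)` (their diagonal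
blocks are automatically unitary). -/
def isotropy (m : ℕ) : Subgroup (SU m) where
  carrier := {g | blockB g = 0 ∧ blockC g = 0}
  one_mem' := by
    constructor
    · ext i j; simp [blockB, Matrix.toBlocks₁₂]
    · ext i j; simp [blockC, Matrix.toBlocks₂₁]
  mul_mem' := by
    rintro a b ⟨ha, ha'⟩ ⟨hb, hb'⟩
    obtain ⟨_, h2, h3, _⟩ := blocks_mul a b
    exact ⟨by rw [h2, ha, hb]; simp, by rw [h3, ha', hb']; simp⟩
  inv_mem' := by
    rintro a ⟨ha, ha'⟩
    obtain ⟨_, h2, h3, _⟩ := blocks_mul a a⁻¹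
    rw [mul_inv_cancel] at h2 h3
    have e2 : blockB (1 : SU m) = 0 := by
      ext i j; simp [blockB, Matrix.toBlocks₁₂]
    have e3 : blockC (1 : SU m) = 0 := by
      ext i j; simp [blockC, Matrix.toBlocks₂₁]
    rw [ha, e2, Matrix.zero_mul, add_zero] at h2
    rw [ha', e3, Matrix.zero_mul, zero_add] at h3
    constructor
    · have := congrArg (fun X => (blockA a)⁻¹ * X) h2
      simpa [Matrix.nonsing_inv_mul_cancel_left _ _
        ((Matrix.isUnit_iff_isUnit_det _).1 (isUnit_blockA a))] using this.symm
    · have := congrArg (fun X => (blockD a)⁻¹ * X) h3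
      simpa [Matrix.nonsing_inv_mul_cancel_left _ _
        ((Matrix.isUnit_iff_isUnit_det _).1 (isUnit_blockD a))] using this.symm

/-- The complex hyperbolic two-plane Grassmannian `SU(2,m) / S(U(2)U(m))`. -/
abbrev Space (m : ℕ) : Type := SU m ⧸ isotropy m

/-- The coordinate space of complex `2 × m` matrices, as a real normed space. It is also `𝔭`, with
`X` standing for the matrix `(0, X; Xᴴ, 0) ∈ 𝔰𝔲(2,m)`. -/
abbrev Coord (m : ℕ) : Type := Fin 2 → Fin m → ℂ

/-- A coordinate vector as a matrix, and back. -/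
abbrev mat {m : ℕ} (W : Coord m) : Matrix (Fin 2) (Fin m) ℂ := Matrix.of W
abbrev vec {m : ℕ} (W : Matrix (Fin 2) (Fin m) ℂ) : Coord m := Matrix.of.symm W

/-- The global (Harish-Chandra) chart of the Grassmannian, `g K ↦ B D⁻¹`. Its image is the bounded
symmetric domain of all `W` with `1 - W Wᴴ` positive definite, an open set, and the graph of `W` is
the orthogonal complement of the definite two-plane `g (ℂ² ⊕ 0)`. All tangent spaces of the
Grassmannian are identified with `Coord m` through this chart. -/
def coord {m : ℕ} (p : Space m) : Coord m :=
  Quotient.liftOn' p (fun g => vec (blockB g * (blockD g)⁻¹)) (by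
    intro a b hab
    have hk : a⁻¹ * b ∈ isotropy m := QuotientGroup.leftRel_apply.1 hab
    obtain ⟨k, rfl⟩ : ∃ k, b = a * k := ⟨a⁻¹ * b, by simp⟩
    rw [inv_mul_cancel_left] at hk
    obtain ⟨_, h2, _, h4⟩ := blocks_mul a k
    have hu := (Matrix.isUnit_iff_isUnit_det _).1 (isUnit_blockD k)
    change vec (blockB a * (blockD a)⁻¹) = vec (blockB (a * k) * (blockD (a * k))⁻¹)
    rw [h2, h4, hk.1, Matrix.mul_zero, Matrix.mul_zero, zero_add, zero_add, Matrix.mul_inv_rev,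
      Matrix.mul_assoc, ← Matrix.mul_assoc (blockD k), Matrix.mul_nonsing_inv _ hu,
      Matrix.one_mul])

lemma coord_mk {m : ℕ} (g : SU m) : coord (g : Space m) = vec (blockB g * (blockD g)⁻¹) := rfl

/-- Left translation by `g`, read in the chart. -/
def moebius {m : ℕ} (g : SU m) (W : Coord m) : Coord m :=
  vec ((blockA g * mat W + blockB g) * (blockC g * mat W + blockD g)⁻¹)

lemma coord_smul {m : ℕ} (g : SU m) (p : Space m) : coord (g • p) = moebius g (coord p) := by
  induction p using QuotientGroup.induction_on with
  | H h =>
    change coord ((g * h : SU m) : Space m) = _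
    obtain ⟨_, h2, _, h4⟩ := blocks_mul g h
    have hu := (Matrix.isUnit_iff_isUnit_det _).1 (isUnit_blockD h)
    have e1 : blockA g * blockB h + blockB g * blockD h =
        (blockA g * (blockB h * (blockD h)⁻¹) + blockB g) * blockD h := by
      rw [Matrix.add_mul, Matrix.mul_assoc, Matrix.mul_assoc, Matrix.nonsing_inv_mul _ hu,
        Matrix.mul_one]
    have e2 : blockC g * blockB h + blockD g * blockD h =
        (blockC g * (blockB h * (blockD h)⁻¹) + blockD g) * blockD h := by
      rw [Matrix.add_mul, Matrix.mul_assoc, Matrix.mul_assoc, Matrix.nonsing_inv_mul _ hu,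
        Matrix.mul_one]
    rw [coord_mk, coord_mk, h2, h4, e1, e2, moebius, mat, vec, Equiv.apply_symm_apply,
      Matrix.mul_inv_rev, Matrix.mul_assoc,
      ← Matrix.mul_assoc (blockD h), Matrix.mul_nonsing_inv _ hu, Matrix.one_mul]

lemma coord_injective {m : ℕ} : Function.Injective (coord (m := m)) := by
  intro p q hpq
  induction p using QuotientGroup.induction_on with
  | H g =>
  induction q using QuotientGroup.induction_on with
  | H h =>
    have h1 : coord (g⁻¹ • (g : Space m)) = coord (g⁻¹ • (h : Space m)) := by
      rw [coord_smul, coord_smul, hpq]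
    change coord ((g⁻¹ * g : SU m) : Space m) = coord ((g⁻¹ * h : SU m) : Space m) at h1
    rw [QuotientGroup.eq]
    generalize g⁻¹ * h = k at h1 ⊢
    have hu := (Matrix.isUnit_iff_isUnit_det _).1 (isUnit_blockD k)
    have hB : blockB k = 0 := by
      rw [inv_mul_cancel, coord_mk, coord_mk] at h1
      have e2 : blockB (1 : SU m) = 0 := (isotropy m).one_mem.1
      rw [e2, Matrix.zero_mul] at h1
      have := congrArg (fun X => X * blockD k) (Matrix.of.symm.injective h1)
      simpa [Matrix.mul_assoc, Matrix.nonsing_inv_mul _ hu] using this.symm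
    refine ⟨hB, ?_⟩
    have h2 := (blocks_unitary k).2.1
    rw [hB, Matrix.mul_zero] at h2
    have := congrArg (fun X => X * (blockD k)⁻¹) h2
    have h3 : (blockC k)ᴴ = 0 := by
      simpa [Matrix.mul_assoc, Matrix.mul_nonsing_inv _ hu] using this.symm
    simpa using h3

/-- The differential at the base point `o` of left translation by `g`. -/
def translate {m : ℕ} (g : SU m) : Coord m →L[ℝ] Coord m := fderiv ℝ (moebius g) 0

lemma translate_apply {m : ℕ} (g : SU m) (X : Coord m) :
    translate g X =
      vec ((blockA g - blockB g * (blockD g)⁻¹ * blockC g) * mat X * (blockD g)⁻¹) := by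
  set L : Matrix (Fin 2) (Fin 2) ℂ := blockA g - blockB g * (blockD g)⁻¹ * blockC g with hL
  have hu := (Matrix.isUnit_iff_isUnit_det _).1 (isUnit_blockD g)
  let bil : Coord m →ₗ[ℝ] (Fin m → Fin m → ℂ) →ₗ[ℝ] Coord m :=
    LinearMap.mk₂ ℝ (fun X T => vec (L * mat X * Matrix.of T))
      (by intros; simp [mat, vec, ← Matrix.of_add_of, Matrix.mul_add, Matrix.add_mul]; rfl)
      (by intros; simp [mat, vec, ← Matrix.smul_of]; rfl)
      (by intros; simp [mat, vec, ← Matrix.of_add_of, Matrix.mul_add]; rfl)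
      (by intros; simp [mat, vec, ← Matrix.smul_of]; rfl)
  let bilc : Coord m →L[ℝ] (Fin m → Fin m → ℂ) →L[ℝ] Coord m :=
    LinearMap.toContinuousLinearMap
      ((LinearMap.toContinuousLinearMap (𝕜 := ℝ)
        (E := Fin m → Fin m → ℂ) (F' := Coord m)).toLinearMap ∘ₗ bil)
  have hbil : ∀ X T, bilc X T = vec (L * mat X * Matrix.of T) := fun X T => rfl
  have hcont : Continuous fun W : Coord m => blockC g * mat W + blockD g :=
    (continuous_const.matrix_mul (continuous_id (X := Coord m))).add continuous_const
  have h0 : (blockC g * mat (0 : Coord m) + blockD g).det ≠ 0 := by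
    simpa [mat] using hu.ne_zero
  let inv : Coord m → Fin m → Fin m → ℂ :=
    fun W => Matrix.of.symm (blockC g * mat W + blockD g)⁻¹
  have hdet : ContinuousAt inv 0 := by
    have : ContinuousAt (fun W : Coord m => (blockC g * mat W + blockD g)⁻¹) 0 := by
      simp only [Matrix.inv_def, Ring.inverse_eq_inv']
      exact (hcont.matrix_det.continuousAt.inv₀ h0).smul hcont.matrix_adjugate.continuousAt
    exact this
  have hinv0 : inv 0 = Matrix.of.symm (blockD g)⁻¹ := by simp [inv, mat]
  have hne : ∀ᶠ W : Coord m in nhds 0, IsUnit (blockC g * mat W + blockD g).det := by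
    filter_upwards [hcont.matrix_det.continuousAt.eventually_ne h0] with W hW
    exact isUnit_iff_ne_zero.2 hW
  have key : HasFDerivAt (moebius g) (bilc.flip (inv 0)) 0 := by
    rw [hasFDerivAt_iff_isLittleO_nhds_zero]
    have h1 : (fun W : Coord m => bilc W (inv W - inv 0)) =o[nhds 0] fun W => W := by
      have hb := bilc.isBoundedBilinearMap.isBigO_comp (l := nhds (0 : Coord m))
        (g := fun W => W) (h := fun W => inv W - inv 0)
      refine hb.trans_isLittleO ?_
      have hz : (fun W : Coord m => ‖inv W - inv 0‖) =o[nhds 0] fun _ => (1 : ℝ) := by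
        rw [Asymptotics.isLittleO_one_iff]
        have := (hdet.sub (continuousAt_const (y := inv 0))).norm
        simpa [ContinuousAt] using this
      have := (Asymptotics.isBigO_refl (fun W : Coord m => ‖W‖) (nhds 0)).mul_isLittleO hz
      simp only [mul_one] at this
      exact this.of_norm_right
    refine h1.congr' ?_ (Filter.Eventually.of_forall fun _ => rfl)
    filter_upwards [hne] with W hW
    have e : moebius g W = vec (blockB g * (blockD g)⁻¹) + bilc W (inv W) := by
      have h2 : L * mat W = (blockA g * mat W + blockB g)
          - blockB g * (blockD g)⁻¹ * (blockC g * mat W + blockD g) := by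
        rw [hL, Matrix.mul_add, Matrix.mul_assoc (blockB g) _ (blockD g),
          Matrix.nonsing_inv_mul _ hu, Matrix.mul_one, Matrix.sub_mul, Matrix.mul_assoc _ _ (mat W)]
        abel
      have h3 : (blockA g * mat W + blockB g) * (blockC g * mat W + blockD g)⁻¹ =
          blockB g * (blockD g)⁻¹ + L * mat W * (blockC g * mat W + blockD g)⁻¹ := by
        rw [h2, Matrix.sub_mul, Matrix.mul_assoc (blockB g * (blockD g)⁻¹),
          Matrix.mul_nonsing_inv _ hW, Matrix.mul_one]
        abel
      rw [moebius, h3]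
      rfl
    have e0 : moebius g 0 = vec (blockB g * (blockD g)⁻¹) := by simp [moebius, mat, vec]
    rw [zero_add, e, e0, ContinuousLinearMap.flip_apply, map_sub]
    abel
  rw [translate, key.fderiv, ContinuousLinearMap.flip_apply, hbil, hinv0,
    Equiv.apply_symm_apply]

lemma blockA_conjTranspose_mul {m : ℕ} (g : SU m) :
    (blockA g)ᴴ * (blockA g - blockB g * (blockD g)⁻¹ * blockC g) = 1 := by
  have hu := (Matrix.isUnit_iff_isUnit_det _).1 (isUnit_blockD g)
  obtain ⟨h1, h2, _⟩ := blocks_unitary g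
  rw [Matrix.mul_sub, h1, ← Matrix.mul_assoc, ← Matrix.mul_assoc, h2,
    Matrix.mul_assoc _ (blockD g), Matrix.mul_nonsing_inv _ hu, Matrix.mul_one]
  abel

lemma one_sub_coord_mul {m : ℕ} (g : SU m) :
    (1 - mat (coord (g : Space m)) * (mat (coord (g : Space m)))ᴴ)⁻¹ =
        blockA g * (blockA g)ᴴ ∧
    (1 - (mat (coord (g : Space m)))ᴴ * mat (coord (g : Space m)))⁻¹ =
        blockD g * (blockD g)ᴴ := by
  set A := blockA g with hA
  set B := blockB g with hB
  set C := blockC g with hC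
  set D := blockD g with hD
  have hu := (Matrix.isUnit_iff_isUnit_det _).1 (isUnit_blockD g)
  have ha := (Matrix.isUnit_iff_isUnit_det _).1 (isUnit_blockA g)
  obtain ⟨u1, u2, u3⟩ := blocks_unitary g
  have l1 := blockA_conjTranspose_mul g
  rw [← hD] at hu u2 u3 l1
  rw [← hA] at ha u1 u2 l1
  rw [← hB] at u2 u3 l1
  rw [← hC] at u1 u2 l1
  have l2 : A - B * D⁻¹ * C = (Aᴴ)⁻¹ := (Matrix.inv_eq_right_inv l1).symm
  have haH : IsUnit (Aᴴ).det := by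
    rw [Matrix.det_conjTranspose]; exact ha.star
  have huH : IsUnit (Dᴴ).det := by
    rw [Matrix.det_conjTranspose]; exact hu.star
  have hW : B * D⁻¹ = (Aᴴ)⁻¹ * Cᴴ := by
    rw [← Matrix.nonsing_inv_mul_cancel_left _ (B * D⁻¹) haH, ← Matrix.mul_assoc (Aᴴ), u2,
      Matrix.mul_assoc, Matrix.mul_nonsing_inv _ hu, Matrix.mul_one]
  have p1 : (1 - (B * D⁻¹) * (B * D⁻¹)ᴴ)⁻¹ = A * Aᴴ := by
    apply Matrix.inv_eq_right_inv
    have : (Aᴴ)⁻¹ * (Aᴴ * A - Cᴴ * C) * A⁻¹ = 1 - (B * D⁻¹) * (B * D⁻¹)ᴴ := by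
      rw [hW, Matrix.mul_sub, Matrix.sub_mul, ← Matrix.mul_assoc, Matrix.nonsing_inv_mul _ haH,
        Matrix.one_mul, Matrix.mul_nonsing_inv _ ha, Matrix.conjTranspose_mul,
        Matrix.conjTranspose_nonsing_inv, Matrix.conjTranspose_conjTranspose,
        Matrix.conjTranspose_conjTranspose]
      simp only [Matrix.mul_assoc]
    rw [← this, u1, add_sub_cancel_right, Matrix.mul_one, Matrix.mul_assoc,
      Matrix.nonsing_inv_mul_cancel_left _ _ ha, Matrix.nonsing_inv_mul _ haH]
  have p2 : (1 - (B * D⁻¹)ᴴ * (B * D⁻¹))⁻¹ = D * Dᴴ := by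
    apply Matrix.inv_eq_right_inv
    have : (Dᴴ)⁻¹ * (Dᴴ * D - Bᴴ * B) * D⁻¹ = 1 - (B * D⁻¹)ᴴ * (B * D⁻¹) := by
      rw [Matrix.mul_sub, Matrix.sub_mul, ← Matrix.mul_assoc, Matrix.nonsing_inv_mul _ huH,
        Matrix.one_mul, Matrix.mul_nonsing_inv _ hu, Matrix.conjTranspose_mul,
        Matrix.conjTranspose_nonsing_inv]
      simp only [Matrix.mul_assoc]
    rw [← this, u3, add_sub_cancel_right, Matrix.mul_one, Matrix.mul_assoc,
      Matrix.nonsing_inv_mul_cancel_left _ _ hu, Matrix.nonsing_inv_mul _ huH]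
  exact ⟨p1, p2⟩

open scoped MatrixOrder in
lemma exists_conj_eq_one {n : Type*} [Fintype n] [DecidableEq n] {P : Matrix n n ℂ}
    (hP : P.PosDef) : ∃ A : Matrix n n ℂ, IsUnit A.det ∧ Aᴴ * P * A = 1 := by
  obtain ⟨Y, hY⟩ := CStarAlgebra.nonneg_iff_eq_star_mul_self.mp hP.posSemidef.nonneg
  rw [Matrix.star_eq_conjTranspose] at hY
  have hu : IsUnit Y.det := by
    have h' := (Matrix.isUnit_iff_isUnit_det _).1 hP.isUnit
    rw [hY, Matrix.det_mul] at h'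
    exact isUnit_of_mul_isUnit_right h'
  have huH : IsUnit (Yᴴ).det := by
    rw [Matrix.det_conjTranspose]; exact hu.star
  refine ⟨Y⁻¹, by simpa using hu, ?_⟩
  rw [hY, Matrix.conjTranspose_nonsing_inv, Matrix.mul_assoc, Matrix.mul_assoc,
    Matrix.mul_nonsing_inv _ hu, Matrix.mul_one, Matrix.nonsing_inv_mul _ huH]

/-- The chart maps onto the bounded symmetric domain. -/
lemma range_coord {m : ℕ} :
    Set.range (coord (m := m)) = {W | (1 - mat W * (mat W)ᴴ).PosDef} := by
  ext W
  constructor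
  · rintro ⟨p, rfl⟩
    induction p using QuotientGroup.induction_on with
    | H g =>
      have hA : (blockA g * (blockA g)ᴴ).PosDef := by
        rw [(Matrix.posSemidef_self_mul_conjTranspose _).posDef_iff_isUnit]
        have ha := isUnit_blockA g
        exact ha.mul (by rw [← Matrix.star_eq_conjTranspose]; exact ha.star)
      have h := hA.inv
      rw [← (one_sub_coord_mul g).1] at h
      by_cases hu : IsUnit (1 - mat (coord (g : Space m)) * (mat (coord (g : Space m)))ᴴ).det
      · rwa [Matrix.nonsing_inv_nonsing_inv _ hu] at h
      · exact absurd hA.isUnit (by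
          rw [← (one_sub_coord_mul g).1, Matrix.nonsing_inv_apply_not_isUnit _ hu]
          exact not_isUnit_zero)
  · intro hW
    set V := mat W with hV
    change (1 - V * Vᴴ).PosDef at hW
    have hW' : (1 - Vᴴ * V).PosDef := by
      have h1 : (1 - Vᴴ * V).PosSemidef := by
        let _ : Invertible (1 : Matrix (Fin 2) (Fin 2) ℂ) := invertibleOne
        let _ : Invertible (1 : Matrix (Fin m) (Fin m) ℂ) := invertibleOne
        have e1 := Matrix.PosDef.fromBlocks₁₁ V (1 : Matrix (Fin m) (Fin m) ℂ)
          (Matrix.PosDef.one (n := Fin 2) (R := ℂ))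
        have e2 := Matrix.PosDef.fromBlocks₂₂ (1 : Matrix (Fin 2) (Fin 2) ℂ) V
          (Matrix.PosDef.one (n := Fin m) (R := ℂ))
        simp only [inv_one, Matrix.mul_one] at e1 e2
        exact e1.1 (e2.2 hW.posSemidef)
      rw [h1.posDef_iff_det_ne_zero, Matrix.det_one_sub_mul_comm]
      exact hW.posSemidef.posDef_iff_det_ne_zero.1 hW
    obtain ⟨A, -, hA⟩ := exists_conj_eq_one hW
    obtain ⟨D, hDu, hD⟩ := exists_conj_eq_one hW'
    set g₀ := Matrix.fromBlocks A (V * D) (Vᴴ * A) D with hg₀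
    have hs : g₀ᴴ * signature m * g₀ = signature m := by
      rw [hg₀, signature, Matrix.fromBlocks_conjTranspose, Matrix.fromBlocks_multiply,
        Matrix.fromBlocks_multiply, Matrix.fromBlocks_inj]
      simp only [Matrix.mul_neg, Matrix.mul_one, Matrix.mul_zero, add_zero, zero_add,
        Matrix.neg_mul, Matrix.conjTranspose_mul, Matrix.conjTranspose_conjTranspose]
      simp only [Matrix.mul_sub, Matrix.sub_mul, Matrix.mul_one] at hA hD
      simp only [Matrix.mul_assoc] at hA hD ⊢
      refine ⟨?_, by simp, by simp, ?_⟩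
      · rw [← hA]; abel
      · rw [← hD]; abel
    have hd : star g₀.det * g₀.det = 1 := by
      have h1 := congrArg Matrix.det hs
      have h2 : (signature m).det = 1 := by
        simp [signature, Matrix.det_neg]
      simpa [Matrix.det_mul, Matrix.det_conjTranspose, h2] using h1
    set d := g₀.det with hdd
    have hd0 : d ≠ 0 := right_ne_zero_of_mul_eq_one hd
    set u : Matrix (Fin 2) (Fin 2) ℂ := Matrix.diagonal ![d⁻¹, 1] with hu
    have huu : uᴴ * u = 1 := by
      rw [hu, Matrix.diagonal_conjTranspose, Matrix.diagonal_mul_diagonal, ← Matrix.diagonal_one]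
      congr 1
      funext i
      fin_cases i
      · simp only [Pi.star_apply, Fin.zero_eta, Matrix.cons_val_zero, star_inv₀, ← mul_inv, hd,
          inv_one]
      · simp
    set k := Matrix.fromBlocks u 0 0 (1 : Matrix (Fin m) (Fin m) ℂ) with hk
    have hks : kᴴ * signature m * k = signature m := by
      rw [hk, signature, Matrix.fromBlocks_conjTranspose, Matrix.fromBlocks_multiply,
        Matrix.fromBlocks_multiply]
      simp [huu]
    have hdet : (g₀ * k).det = 1 := by
      rw [Matrix.det_mul, ← hdd, hk, Matrix.det_fromBlocks_zero₂₁, hu, Matrix.det_diagonal]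
      simp [hd0]
    let g : SU m := ⟨⟨g₀ * k, hdet⟩, by
      change (g₀ * k)ᴴ * signature m * (g₀ * k) = signature m
      calc (g₀ * k)ᴴ * signature m * (g₀ * k) = kᴴ * (g₀ᴴ * signature m * g₀) * k := by
            simp only [Matrix.conjTranspose_mul, Matrix.mul_assoc]
        _ = signature m := by rw [hs, hks]⟩
    refine ⟨(g : Space m), ?_⟩
    have hg : g.1.1 = Matrix.fromBlocks (A * u) (V * D) (Vᴴ * A * u) D := by
      change g₀ * k = _
      rw [hg₀, hk, Matrix.fromBlocks_multiply]
      simp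
    rw [coord_mk, blockB, blockD, hg, Matrix.toBlocks_fromBlocks₁₂, Matrix.toBlocks_fromBlocks₂₂,
      Matrix.mul_assoc, Matrix.mul_nonsing_inv _ hDu, Matrix.mul_one]
    rfl

/-- The Riemannian metric in the chart. It is the `SU(2,m)`-invariant metric that is
`Re tr (X Yᴴ)` on `𝔭 = T_o` (see `metric_zero`, `metric_translate`), a constant multiple of the
Killing metric, normalized so that the minimal sectional curvature is `-4`. -/
def metric {m : ℕ} (W X Y : Coord m) : ℝ :=
  (((1 - mat W * (mat W)ᴴ)⁻¹ * mat X * (1 - (mat W)ᴴ * mat W)⁻¹ * (mat Y)ᴴ).trace).re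

lemma metric_zero {m : ℕ} (X Y : Coord m) : metric 0 X Y = ((mat X * (mat Y)ᴴ).trace).re := by
  simp [metric, mat]

lemma metric_translate {m : ℕ} (g : SU m) (X Y : Coord m) :
    metric (coord (g : Space m)) (translate g X) (translate g Y) = metric 0 X Y := by
  obtain ⟨p1, p2⟩ := one_sub_coord_mul g
  have l2 := (Matrix.inv_eq_right_inv (blockA_conjTranspose_mul g)).symm
  have hu := (Matrix.isUnit_iff_isUnit_det _).1 (isUnit_blockD g)
  have ha := (Matrix.isUnit_iff_isUnit_det _).1 (isUnit_blockA g)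
  rw [metric_zero, metric, p1, p2, translate_apply, translate_apply, l2]
  set A := blockA g
  set D := blockD g
  have haH : IsUnit (Aᴴ).det := by
    rw [Matrix.det_conjTranspose]; exact ha.star
  have huH : IsUnit (Dᴴ).det := by
    rw [Matrix.det_conjTranspose]; exact hu.star
  have hY : ((Aᴴ)⁻¹ * mat Y * D⁻¹)ᴴ = (Dᴴ)⁻¹ * (mat Y)ᴴ * A⁻¹ := by
    rw [Matrix.conjTranspose_mul, Matrix.conjTranspose_mul, Matrix.conjTranspose_nonsing_inv,
      Matrix.conjTranspose_nonsing_inv, Matrix.conjTranspose_conjTranspose, Matrix.mul_assoc]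
  simp only [mat, vec, Equiv.apply_symm_apply]
  simp only [mat] at hY
  rw [hY]
  have : A * Aᴴ * ((Aᴴ)⁻¹ * Matrix.of X * D⁻¹) * (D * Dᴴ) * ((Dᴴ)⁻¹ * (Matrix.of Y)ᴴ * A⁻¹) =
      A * (Matrix.of X * (Matrix.of Y)ᴴ) * A⁻¹ := by
    simp only [Matrix.mul_assoc]
    rw [Matrix.mul_nonsing_inv_cancel_left _ _ haH, Matrix.nonsing_inv_mul_cancel_left _ _ hu,
      Matrix.mul_nonsing_inv_cancel_left _ _ huH]
  rw [this, Matrix.trace_mul_comm, ← Matrix.mul_assoc, Matrix.nonsing_inv_mul _ ha,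
    Matrix.one_mul]

/-- The Kähler structure `J`, the same at every point of the chart. On `𝔭 = T_o` it is the adjoint
action of `diag (m i / (m + 2) I₂, -2 i / (m + 2) I_m)`, that is, multiplication by `i`. -/
def kaehler {m : ℕ} : Coord m →ₗ[ℝ] Coord m where
  toFun X := Complex.I • X
  map_add' := by intros; simp
  map_smul' := by intro c X; simp [smul_comm c Complex.I X]

/-- The Kähler structure is invariant under `SU(2,m)`. -/
lemma translate_kaehler {m : ℕ} (g : SU m) (X : Coord m) :
    translate g (kaehler X) = kaehler (translate g X) := by
  have h : mat (kaehler X) = Complex.I • mat X := rfl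
  rw [translate_apply, translate_apply, h, Matrix.mul_smul, Matrix.smul_mul]
  rfl

/-- The quaternionic Kähler structure `𝔍` at `p`: the endomorphisms of the tangent space at
`p = g o` that correspond under the translation by `g` to the adjoint action on `𝔭 = T_o` of an
element `diag (q, 0)`, `q ∈ 𝔰𝔲(2)`. -/
def quaternionic {m : ℕ} (p : Space m) : Set (Coord m →ₗ[ℝ] Coord m) :=
  {T | ∃ g : SU m, (g : Space m) = p ∧ ∃ q : Matrix (Fin 2) (Fin 2) ℂ, qᴴ = -q ∧ q.trace = 0 ∧
    ∀ X, T (translate g X) = translate g (vec (q * mat X))}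

/-- `J₁, J₂, J₃` (indices modulo 3) are the values at `p` of a canonical local basis of `𝔍`. -/
structure IsCanonicalBasis {m : ℕ} (p : Space m) (Jq : Fin 3 → Coord m →ₗ[ℝ] Coord m) : Prop where
  mem : ∀ ν, Jq ν ∈ quaternionic p
  sq : ∀ ν X, Jq ν (Jq ν X) = -X
  isometry : ∀ ν X Y, metric (coord p) (Jq ν X) (Jq ν Y) = metric (coord p) X Y
  mul : ∀ ν X, Jq ν (Jq (ν + 1) X) = Jq (ν + 2) X
  mul_rev : ∀ ν X, Jq (ν + 1) (Jq ν X) = -Jq (ν + 2) X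

/-- `V` is the Christoffel symbol `Γ_W(X, Y)` of the Levi-Civita connection of the metric in the
chart. -/
def IsChristoffel {m : ℕ} (W X Y V : Coord m) : Prop :=
  ∀ U, 2 * metric W V U =
    fderiv ℝ (fun W' => metric W' Y U) W X + fderiv ℝ (fun W' => metric W' X U) W Y
      - fderiv ℝ (fun W' => metric W' X Y) W U

/-- The Christoffel symbol `Γ_W(X, Y)`; it exists and is unique on the image of the chart, where the
metric is positive definite. -/
def christoffel {m : ℕ} (W X Y : Coord m) : Coord m := Classical.epsilon (IsChristoffel W X Y)

/-! ### Real hypersurfaces -/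

/-- A smooth immersed real hypersurface `M` of `SU(2,m) / S(U(2)U(m))`, with a global smooth unit
normal vector field `N`. The ambient space is diffeomorphic to an open subset of a vector space, so
such a field exists if and only if `M` is orientable. Tangent vectors of the ambient space are read
in the chart. -/
structure OrientedHypersurface (m : ℕ) (M : Type*) [TopologicalSpace M]
    [ChartedSpace (EuclideanSpace ℝ (Fin (4 * m - 1))) M] where
  toFun : M → Space m
  normal : M → Coord m
  smooth : ContMDiff (𝓡 (4 * m - 1)) 𝓘(ℝ, Coord m) ∞ fun x => coord (toFun x)
  immersion : ∀ x, Function.Injective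
    (mvfderiv (𝓡 (4 * m - 1)) (fun y => coord (toFun y)) x)
  smooth_normal : ContMDiff (𝓡 (4 * m - 1)) 𝓘(ℝ, Coord m) ∞ normal
  normal_unit : ∀ x, metric (coord (toFun x)) (normal x) (normal x) = 1
  normal_orthogonal : ∀ x X, metric (coord (toFun x))
    (mvfderiv (𝓡 (4 * m - 1)) (fun y => coord (toFun y)) x X) (normal x) = 0

namespace OrientedHypersurface

variable {m : ℕ} {M : Type*} [TopologicalSpace M]
  [ChartedSpace (EuclideanSpace ℝ (Fin (4 * m - 1))) M] (S : OrientedHypersurface m M)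

/-- The differential of the immersion. -/
def diff (x : M) : TangentSpace (𝓡 (4 * m - 1)) x →L[ℝ] Coord m :=
  mvfderiv (𝓡 (4 * m - 1)) (fun y => coord (S.toFun y)) x

/-- The ambient inner product at the point of `x`. -/
def ambient (x : M) (v w : Coord m) : ℝ := metric (coord (S.toFun x)) v w

/-- The induced Riemannian metric `g` on `M`. -/
def g (x : M) (X Y : TangentSpace (𝓡 (4 * m - 1)) x) : ℝ :=
  S.ambient x (S.diff x X) (S.diff x Y)

/-- The tangential component of an ambient vector, the tangent vector `X` of `M` with
`v = X + ⟨v, N⟩ N`. -/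
def tangential (x : M) (v : Coord m) : TangentSpace (𝓡 (4 * m - 1)) x :=
  Classical.epsilon fun X => v = S.diff x X + S.ambient x v (S.normal x) • S.normal x

/-- The ambient Levi-Civita derivative `∇̄_X V` of a vector field `V` along the hypersurface. -/
def ambientCov (V : M → Coord m) (x : M) (X : TangentSpace (𝓡 (4 * m - 1)) x) : Coord m :=
  mvfderiv (𝓡 (4 * m - 1)) V x X
    + christoffel (coord (S.toFun x)) (S.diff x X) (V x)

/-- The shape operator `A X = -∇̄_X N`. -/
def shape (x : M) (X : TangentSpace (𝓡 (4 * m - 1)) x) : TangentSpace (𝓡 (4 * m - 1)) x :=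
  S.tangential x (-S.ambientCov S.normal x X)

/-- For an endomorphism `T` of the ambient tangent space at `x` (such as `J` or `J_ν`), the
tangential component `φ X` in `T X = φ X + η(X) N`. -/
def phi (x : M) (T : Coord m →ₗ[ℝ] Coord m) (X : TangentSpace (𝓡 (4 * m - 1)) x) :
    TangentSpace (𝓡 (4 * m - 1)) x :=
  S.tangential x (T (S.diff x X))

/-- The normal component `η(X)` in `T X = φ X + η(X) N`. -/
def eta (x : M) (T : Coord m →ₗ[ℝ] Coord m) (X : TangentSpace (𝓡 (4 * m - 1)) x) : ℝ :=
  S.ambient x (T (S.diff x X)) (S.normal x)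

/-- The structure tensor `φ` and the one-form `η` that the Kähler structure `J` induces on `M`. -/
abbrev φ (x : M) (X : TangentSpace (𝓡 (4 * m - 1)) x) : TangentSpace (𝓡 (4 * m - 1)) x :=
  S.phi x kaehler X
abbrev η (x : M) (X : TangentSpace (𝓡 (4 * m - 1)) x) : ℝ := S.eta x kaehler X

/-- The Reeb vector field `ξ = -J N`. -/
def reeb (x : M) : TangentSpace (𝓡 (4 * m - 1)) x :=
  S.tangential x (-kaehler (S.normal x))

/-- The right-hand side of the Koszul formula for `2 g(∇_X Y, W)`, with `∇` the Levi-Civita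
connection of `(M, g)`. -/
def koszul (X Y W : Π x : M, TangentSpace (𝓡 (4 * m - 1)) x) (x : M) : ℝ :=
  mvfderiv (𝓡 (4 * m - 1)) (fun y => S.g y (Y y) (W y)) x (X x)
    + mvfderiv (𝓡 (4 * m - 1)) (fun y => S.g y (X y) (W y)) x (Y x)
    - mvfderiv (𝓡 (4 * m - 1)) (fun y => S.g y (X y) (Y y)) x (W x)
    + S.g x (VectorField.mlieBracket (𝓡 (4 * m - 1)) X Y x) (W x)
    - S.g x (VectorField.mlieBracket (𝓡 (4 * m - 1)) X W x) (Y x)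
    - S.g x (VectorField.mlieBracket (𝓡 (4 * m - 1)) Y W x) (X x)

variable [IsManifold (𝓡 (4 * m - 1)) ∞ M]

/-- `V = (∇_X Y)(x)` for the Levi-Civita connection `∇` of `(M, g)`, where `X` and `Y` are smooth
vector fields on `M`. -/
def IsLeviCivita (X Y : Π x : M, TangentSpace (𝓡 (4 * m - 1)) x) (x : M)
    (V : TangentSpace (𝓡 (4 * m - 1)) x) : Prop :=
  ∀ W : Π y : M, TangentSpace (𝓡 (4 * m - 1)) y,
    ContMDiffAt (𝓡 (4 * m - 1)) (𝓡 (4 * m - 1)).tangent ∞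
      (fun y => (⟨y, W y⟩ : TangentBundle (𝓡 (4 * m - 1)) M)) x →
    2 * S.g x V (W x) = S.koszul X Y W x

/-- The Reeb flow is geodesic: `∇_ξ ξ = 0`, that is, the integral curves of `ξ` are geodesics
of `(M, g)`. -/
def GeodesicReebFlow : Prop := ∀ x, S.IsLeviCivita S.reeb S.reeb x 0

end OrientedHypersurface

end HyperbolicGrassmannian
end

/-!
Since `J` is parallel, `∇̄_X ξ = -J ∇̄_X N`, so `∇_ξ ξ = 0` forces `∇̄_ξ N` to be a multiple of
`J N`: the Reeb field is principal, with principal curvature `α = g(Aξ, ξ)`. By the symmetry of `A`,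
this says `⟨∇̄_X N, J N⟩ = α η(X)` for every `X`. Differentiating this identity along `Y` and
antisymmetrizing, the second derivatives of `N` combine to the ambient curvature and leave
`⟨R(X, Y) N, J N⟩ + 2 g(AφAX, Y) = dα(X) η(Y) - dα(Y) η(X) + α g((Aφ + φA) X, Y)`. The case
`X = ξ` expresses `dα` through `⟨R(ξ, Y) N, J N⟩`, and eliminating it leaves only curvature terms.

These are algebraic. Transported to the point `W`, the trace form of `𝔭` becomes
`h(X, Y) = tr(X (1 - Wᴴ W)⁻¹ Yᴴ (1 - W Wᴴ)⁻¹)`, and the curvature is a combination of the traces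
`tr(X Yᴴ Z Vᴴ)` of the isotropy representation. The canonical basis acts on the left by an
imaginary quaternion triple `q_ν` of `2 × 2` matrices, for which
`∑ tr(q_ν A) tr(q_ν B) = tr A tr B - 2 tr(A B)`. Hence `∑ h(J_ν X, Y) h(J_ν Z, V)` is
`h(X, Y) h(Z, V) - 2 tr(X Yᴴ Z Vᴴ)`, whose real and imaginary parts are the sums in the theorem.
-/

noncomputable section

namespace HyperbolicGrassmannian

open scoped Matrix.Norms.Elementwise

/-! ### Calculus of matrix-valued functions -/

section MatrixCalculus

variable {l m n : Type*}

section Deriv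

variable {t : ℝ}

lemma hasDerivAt_matrix [Finite n] {F : ℝ → Matrix m n ℂ} {F' : Matrix m n ℂ} :
    HasDerivAt F F' t ↔ ∀ i j, HasDerivAt (fun s => F s i j) (F' i j) t :=
  have := Fintype.ofFinite n
  hasDerivAt_pi.trans (forall_congr' fun _ => hasDerivAt_pi)

lemma hasDerivAt_matrix_mul [Fintype m] [Finite n] {F : ℝ → Matrix l m ℂ} {F' : Matrix l m ℂ}
    {G : ℝ → Matrix m n ℂ} {G' : Matrix m n ℂ} (hF : HasDerivAt F F' t) (hG : HasDerivAt G G' t) :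
    HasDerivAt (fun s => F s * G s) (F' * G t + F t * G') t := by
  rw [hasDerivAt_matrix] at *
  intro i j
  simp only [Matrix.mul_apply, Matrix.add_apply, ← Finset.sum_add_distrib]
  exact HasDerivAt.fun_sum fun k _ => (hF i k).mul (hG k j)

lemma hasDerivAt_matrix_conjTranspose [Finite m] [Finite n] {F : ℝ → Matrix m n ℂ}
    {F' : Matrix m n ℂ} (hF : HasDerivAt F F' t) : HasDerivAt (fun s => (F s)ᴴ) F'ᴴ t :=
  hasDerivAt_matrix.2 fun i j => (hasDerivAt_matrix.1 hF j i).star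

lemma hasDerivAt_matrix_trace [Fintype n] {F : ℝ → Matrix n n ℂ} {F' : Matrix n n ℂ}
    (hF : HasDerivAt F F' t) : HasDerivAt (fun s => (F s).trace) F'.trace t :=
  HasDerivAt.fun_sum fun i _ => hasDerivAt_matrix.1 hF i i

end Deriv

section ContDiff

variable [Fintype n] {E : Type*} [NormedAddCommGroup E] [NormedSpace ℝ E] {k : WithTop ℕ∞} {u : E}

lemma contDiffAt_matrix [Fintype m] {F : E → Matrix m n ℂ} :
    ContDiffAt ℝ k F u ↔ ∀ i j, ContDiffAt ℝ k (fun v => F v i j) u :=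
  contDiffAt_pi.trans (forall_congr' fun _ => contDiffAt_pi)

lemma contDiffAt_matrix_mul [Fintype l] [Fintype m] {F : E → Matrix l m ℂ} {G : E → Matrix m n ℂ}
    (hF : ContDiffAt ℝ k F u) (hG : ContDiffAt ℝ k G u) :
    ContDiffAt ℝ k (fun v => F v * G v) u := by
  rw [contDiffAt_matrix] at *
  intro i j
  simp only [Matrix.mul_apply]
  exact ContDiffAt.sum fun r _ => (hF i r).mul (hG r j)

lemma contDiffAt_matrix_conjTranspose [Fintype m] {F : E → Matrix m n ℂ} (hF : ContDiffAt ℝ k F u) :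
    ContDiffAt ℝ k (fun v => (F v)ᴴ) u :=
  contDiffAt_matrix.2 fun i j =>
    Complex.conjCLE.contDiff.contDiffAt.comp u (contDiffAt_matrix.1 hF j i)

lemma contDiffAt_matrix_trace {F : E → Matrix n n ℂ} (hF : ContDiffAt ℝ k F u) :
    ContDiffAt ℝ k (fun v => (F v).trace) u :=
  ContDiffAt.sum fun i _ => contDiffAt_matrix.1 hF i i

variable [DecidableEq n]

lemma contDiffAt_matrix_det {F : E → Matrix n n ℂ} (hF : ContDiffAt ℝ k F u) :
    ContDiffAt ℝ k (fun v => (F v).det) u := by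
  simp only [Matrix.det_apply]
  exact ContDiffAt.sum fun σ _ =>
    (contDiffAt_prod fun i _ => contDiffAt_matrix.1 hF (σ i) i).const_smul _

lemma contDiffAt_matrix_inv {F : E → Matrix n n ℂ} (hF : ContDiffAt ℝ k F u)
    (hu : IsUnit (F u).det) : ContDiffAt ℝ k (fun v => (F v)⁻¹) u := by
  simp only [Matrix.inv_def, Ring.inverse_eq_inv']
  refine ((contDiffAt_matrix_det hF).inv hu.ne_zero).smul (contDiffAt_matrix.2 fun i j => ?_)
  simp only [Matrix.adjugate_apply]
  refine contDiffAt_matrix_det (contDiffAt_matrix.2 fun r s => ?_)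
  by_cases h : r = j
  · simpa only [Matrix.updateRow_apply, if_pos h] using contDiffAt_const
  · simpa only [Matrix.updateRow_apply, if_neg h] using contDiffAt_matrix.1 hF r s

lemma hasDerivAt_matrix_inv {F : ℝ → Matrix n n ℂ} {F' : Matrix n n ℂ} {t : ℝ}
    (hF : HasDerivAt F F' t) (hu : IsUnit (F t).det) :
    HasDerivAt (fun s => (F s)⁻¹) (-((F t)⁻¹ * F' * (F t)⁻¹)) t := by
  have hdiff : DifferentiableAt ℝ (fun A : Matrix n n ℂ => A⁻¹) (F t) :=
    (contDiffAt_matrix_inv (k := 1) contDiffAt_id hu).differentiableAt one_ne_zero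
  have hG := (hdiff.comp t hF.differentiableAt).hasDerivAt
  set G' := deriv ((fun A : Matrix n n ℂ => A⁻¹) ∘ F) t
  have hone : ∀ᶠ s in nhds t, (F s)⁻¹ * F s = 1 := by
    have hdet : ContinuousAt (fun s => (F s).det) t :=
      (continuous_id.matrix_det.continuousAt (x := F t)).comp hF.continuousAt
    filter_upwards [hdet.eventually_ne hu.ne_zero] with s hs
    exact Matrix.nonsing_inv_mul _ hs.isUnit
  have hzero : G' * F t + (F t)⁻¹ * F' = 0 :=
    (hasDerivAt_matrix_mul hG hF).unique ((hasDerivAt_const t 1).congr_of_eventuallyEq hone)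
  have hG' : G' = -((F t)⁻¹ * F' * (F t)⁻¹) := by
    rw [← Matrix.mul_nonsing_inv_cancel_right _ G' hu, eq_neg_of_add_eq_zero_left hzero,
      Matrix.neg_mul]
  exact hG' ▸ hG

end ContDiff

end MatrixCalculus

/-! ### The Hermitian metric and its Christoffel symbols -/

section Weights

variable {m : ℕ}

/-- The inverse `(1 - W Wᴴ)⁻¹`, which weights the `ℂ²`-factor in the metric at `W`. -/
def leftWeight (W : Coord m) : Matrix (Fin 2) (Fin 2) ℂ := (1 - mat W * (mat W)ᴴ)⁻¹

/-- The inverse `(1 - Wᴴ W)⁻¹`, which weights the `ℂᵐ`-factor in the metric at `W`. -/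
def rightWeight (W : Coord m) : Matrix (Fin m) (Fin m) ℂ := (1 - (mat W)ᴴ * mat W)⁻¹

/-- The matrix `Wᴴ (1 - W Wᴴ)⁻¹ = (1 - Wᴴ W)⁻¹ Wᴴ` of the Christoffel symbols at `W`. -/
def mixedWeight (W : Coord m) : Matrix (Fin m) (Fin 2) ℂ := (mat W)ᴴ * leftWeight W

/-- The points of the coordinate space at which the two weights are genuine inverses. -/
def Regular (W : Coord m) : Prop := IsUnit (1 - mat W * (mat W)ᴴ).det

lemma regular_coord (p : Space m) : Regular (coord p) := by
  have h : coord p ∈ Set.range (coord (m := m)) := ⟨p, rfl⟩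
  rw [range_coord] at h
  exact (Matrix.isUnit_iff_isUnit_det _).1 (Matrix.PosDef.isUnit h)

lemma conjTranspose_leftWeight (W : Coord m) : (leftWeight W)ᴴ = leftWeight W := by
  simp [leftWeight, Matrix.conjTranspose_nonsing_inv]

lemma conjTranspose_rightWeight (W : Coord m) : (rightWeight W)ᴴ = rightWeight W := by
  simp [rightWeight, Matrix.conjTranspose_nonsing_inv]

lemma conjTranspose_mixedWeight (W : Coord m) : (mixedWeight W)ᴴ = leftWeight W * mat W := by
  rw [mixedWeight, Matrix.conjTranspose_mul, conjTranspose_leftWeight,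
    Matrix.conjTranspose_conjTranspose]

namespace Regular

variable {W : Coord m}

lemma isUnit_det_right (h : Regular W) : IsUnit (1 - (mat W)ᴴ * mat W).det := by
  rw [Matrix.det_one_sub_mul_comm]
  exact h

lemma rightWeight_mul_conjTranspose (h : Regular W) :
    rightWeight W * (mat W)ᴴ = mixedWeight W := by
  have hcomm : (1 - (mat W)ᴴ * mat W) * (mat W)ᴴ = (mat W)ᴴ * (1 - mat W * (mat W)ᴴ) := by
    simp only [Matrix.mul_sub, Matrix.sub_mul, Matrix.mul_one, Matrix.one_mul, Matrix.mul_assoc]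
  calc rightWeight W * (mat W)ᴴ
      = rightWeight W * ((mat W)ᴴ * (1 - mat W * (mat W)ᴴ)) * leftWeight W := by
        rw [leftWeight, Matrix.mul_assoc, Matrix.mul_nonsing_inv_cancel_right _ _ h]
    _ = mixedWeight W := by
        rw [← hcomm, rightWeight, Matrix.nonsing_inv_mul_cancel_left _ _ h.isUnit_det_right,
          mixedWeight]

lemma mul_rightWeight (h : Regular W) : mat W * rightWeight W = (mixedWeight W)ᴴ := by
  rw [← h.rightWeight_mul_conjTranspose, Matrix.conjTranspose_mul, conjTranspose_rightWeight,
    Matrix.conjTranspose_conjTranspose]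

lemma rightWeight_eq (h : Regular W) : rightWeight W = 1 + mixedWeight W * mat W := by
  have hinv : rightWeight W * (1 - (mat W)ᴴ * mat W) = 1 :=
    Matrix.nonsing_inv_mul _ h.isUnit_det_right
  rwa [Matrix.mul_sub, Matrix.mul_one, sub_eq_iff_eq_add, ← Matrix.mul_assoc,
    h.rightWeight_mul_conjTranspose] at hinv

end Regular

end Weights

section HermitianForm

variable {m : ℕ}

/-- The Hermitian form, linear in the first argument, whose real part is the metric. -/
def hermitianForm (W X Y : Coord m) : ℂ :=
  (leftWeight W * mat X * rightWeight W * (mat Y)ᴴ).trace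

lemma metric_eq_re (W X Y : Coord m) : metric W X Y = (hermitianForm W X Y).re := rfl

lemma hermitianForm_add_left (W X X' Y : Coord m) :
    hermitianForm W (X + X') Y = hermitianForm W X Y + hermitianForm W X' Y := by
  simp only [hermitianForm, mat, ← Matrix.of_add_of, Matrix.mul_add, Matrix.add_mul,
    Matrix.trace_add]

lemma hermitianForm_smul_left (W : Coord m) (c : ℂ) (X Y : Coord m) :
    hermitianForm W (c • X) Y = c * hermitianForm W X Y := by
  simp only [hermitianForm, mat, ← Matrix.smul_of, Matrix.mul_smul, Matrix.smul_mul,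
    Matrix.trace_smul, smul_eq_mul]

lemma star_hermitianForm (W X Y : Coord m) :
    star (hermitianForm W X Y) = hermitianForm W Y X := by
  rw [hermitianForm, ← Matrix.trace_conjTranspose, hermitianForm]
  simp only [Matrix.conjTranspose_mul, Matrix.conjTranspose_conjTranspose,
    conjTranspose_leftWeight, conjTranspose_rightWeight]
  rw [← Matrix.mul_assoc, ← Matrix.mul_assoc, Matrix.trace_mul_comm]
  simp only [Matrix.mul_assoc]

lemma hermitianForm_add_right (W X Y Y' : Coord m) :
    hermitianForm W X (Y + Y') = hermitianForm W X Y + hermitianForm W X Y' := by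
  rw [← star_hermitianForm, hermitianForm_add_left, star_add, star_hermitianForm,
    star_hermitianForm]

lemma hermitianForm_smul_right (W : Coord m) (c : ℂ) (X Y : Coord m) :
    hermitianForm W X (c • Y) = star c * hermitianForm W X Y := by
  rw [← star_hermitianForm, hermitianForm_smul_left, star_mul', star_hermitianForm]

lemma metric_comm (W X Y : Coord m) : metric W X Y = metric W Y X := by
  rw [metric_eq_re, metric_eq_re, ← star_hermitianForm W Y X]
  rfl

lemma metric_add_left (W X X' Y : Coord m) :
    metric W (X + X') Y = metric W X Y + metric W X' Y := by
  simp only [metric_eq_re, hermitianForm_add_left, Complex.add_re]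

lemma metric_smul_left (W : Coord m) (r : ℝ) (X Y : Coord m) :
    metric W (r • X) Y = r * metric W X Y := by
  rw [metric_eq_re, ← Complex.coe_smul, hermitianForm_smul_left, Complex.re_ofReal_mul,
    metric_eq_re]

lemma metric_smul_right (W : Coord m) (r : ℝ) (X Y : Coord m) :
    metric W X (r • Y) = r * metric W X Y := by
  simp only [metric_comm W X, metric_smul_left]

lemma metric_neg_left (W X Y : Coord m) : metric W (-X) Y = -metric W X Y := by
  rw [← neg_one_smul ℝ X, metric_smul_left, neg_one_mul]

lemma metric_neg_right (W X Y : Coord m) : metric W X (-Y) = -metric W X Y := by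
  simp only [metric_comm W X, metric_neg_left]

lemma metric_sub_left (W X X' Y : Coord m) :
    metric W (X - X') Y = metric W X Y - metric W X' Y := by
  rw [sub_eq_add_neg, metric_add_left, metric_neg_left, ← sub_eq_add_neg]

lemma metric_zero_left (W Y : Coord m) : metric W 0 Y = 0 := by
  rw [← zero_smul ℝ (0 : Coord m), metric_smul_left, zero_mul]

lemma kaehler_apply (X : Coord m) : kaehler X = Complex.I • X := rfl

lemma kaehler_kaehler (X : Coord m) : kaehler (kaehler X) = -X := by
  rw [kaehler_apply, kaehler_apply, smul_smul, Complex.I_mul_I, neg_one_smul]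

lemma metric_kaehler_left (W X Y : Coord m) : metric W (kaehler X) Y = -metric W X (kaehler Y) := by
  simp [metric_eq_re, kaehler_apply, hermitianForm_smul_left, hermitianForm_smul_right]

lemma metric_kaehler_kaehler (W X Y : Coord m) :
    metric W (kaehler X) (kaehler Y) = metric W X Y := by
  rw [metric_kaehler_left, kaehler_kaehler, metric_neg_right, neg_neg]

lemma metric_kaehler_self (W X : Coord m) : metric W (kaehler X) X = 0 := by
  have h := metric_kaehler_left W X X
  rw [metric_comm W X] at h
  linarith

lemma mat_translate (g : SU m) (X : Coord m) :
    mat (translate g X) = ((blockA g)ᴴ)⁻¹ * mat X * (blockD g)⁻¹ := by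
  rw [translate_apply, Matrix.inv_eq_right_inv (blockA_conjTranspose_mul g)]
  exact Equiv.apply_symm_apply _ _

lemma translate_vec (g : SU m) (X : Coord m) :
    translate g (vec ((blockA g)ᴴ * mat X * blockD g)) = X := by
  have hA : IsUnit ((blockA g)ᴴ).det :=
    (Matrix.isUnit_iff_isUnit_det _).1 (isUnit_blockA g).star
  have hD : IsUnit (blockD g).det := (Matrix.isUnit_iff_isUnit_det _).1 (isUnit_blockD g)
  apply Matrix.of.injective
  rw [← mat, mat_translate, mat, vec, Equiv.apply_symm_apply, Matrix.mul_assoc (blockA g)ᴴ,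
    Matrix.nonsing_inv_mul_cancel_left _ _ hA, Matrix.mul_nonsing_inv_cancel_right _ _ hD]

lemma metric_zero_self_pos {X : Coord m} (hX : X ≠ 0) : 0 < metric 0 X X := by
  rw [metric_zero]
  have hnonneg : 0 ≤ (mat X * (mat X)ᴴ).trace :=
    (Matrix.posSemidef_self_mul_conjTranspose (mat X)).trace_nonneg
  have hne : (mat X * (mat X)ᴴ).trace ≠ 0 := by
    rw [Ne, Matrix.trace_mul_conjTranspose_self_eq_zero_iff]
    exact fun h => hX (Matrix.of.injective h)
  exact (Complex.lt_def.1 (hnonneg.lt_of_ne' hne)).1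

lemma metric_self_pos (p : Space m) {X : Coord m} (hX : X ≠ 0) : 0 < metric (coord p) X X := by
  induction p using QuotientGroup.induction_on with
  | H g =>
    rw [← translate_vec g X] at hX ⊢
    rw [metric_translate]
    exact metric_zero_self_pos fun h => hX (by rw [h, map_zero])

lemma eq_of_metric_eq (p : Space m) {X Y : Coord m}
    (h : ∀ U, metric (coord p) X U = metric (coord p) Y U) : X = Y := by
  by_contra hne
  have hpos := metric_self_pos p (sub_ne_zero.2 hne)
  rw [metric_sub_left, h, sub_self] at hpos
  exact hpos.false

end HermitianForm

section Christoffel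

variable {m : ℕ}

/-- The closed form `X Wᴴ (1 - W Wᴴ)⁻¹ Y + Y Wᴴ (1 - W Wᴴ)⁻¹ X` of the Christoffel symbol
`Γ_W(X, Y)`. -/
def christoffelForm (W X Y : Coord m) : Coord m :=
  vec (mat X * mixedWeight W * mat Y + mat Y * mixedWeight W * mat X)

lemma christoffelForm_comm (W X Y : Coord m) : christoffelForm W X Y = christoffelForm W Y X := by
  rw [christoffelForm, christoffelForm, add_comm]

lemma christoffelForm_add_right (W X Y Z : Coord m) :
    christoffelForm W X (Y + Z) = christoffelForm W X Y + christoffelForm W X Z := by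
  apply Matrix.of.injective
  simp only [christoffelForm, mat, vec, ← Matrix.of_add_of, Equiv.apply_symm_apply,
    Matrix.mul_add, Matrix.add_mul]
  abel

lemma christoffelForm_smul_right (W : Coord m) (c : ℂ) (X Y : Coord m) :
    christoffelForm W X (c • Y) = c • christoffelForm W X Y := by
  apply Matrix.of.injective
  simp only [christoffelForm, mat, vec, ← Matrix.smul_of, Equiv.apply_symm_apply,
    Matrix.mul_smul, Matrix.smul_mul, smul_add]

/-- The directional derivative of `W ↦ Γ_W(X, Y)` at `W` in the direction `V`, in closed form. -/
def christoffelDeriv (W V X Y : Coord m) : Coord m :=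
  let K' := rightWeight W * (mat V)ᴴ * leftWeight W + mixedWeight W * mat V * mixedWeight W
  vec (mat X * K' * mat Y + mat Y * K' * mat X)

end Christoffel

section Smooth

variable {m : ℕ} {E : Type*} [NormedAddCommGroup E] [NormedSpace ℝ E] {k : WithTop ℕ∞} {u : E}
  {W X Y : E → Coord m}

lemma contDiffAt_mat (hX : ContDiffAt ℝ k X u) : ContDiffAt ℝ k (fun v => mat (X v)) u := hX

lemma contDiffAt_leftWeight (hW : ContDiffAt ℝ k W u) (h : Regular (W u)) :
    ContDiffAt ℝ k (fun v => leftWeight (W v)) u :=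
  have hM := contDiffAt_mat hW
  contDiffAt_matrix_inv (contDiffAt_const.sub
    (contDiffAt_matrix_mul hM (contDiffAt_matrix_conjTranspose hM))) h

lemma contDiffAt_rightWeight (hW : ContDiffAt ℝ k W u) (h : Regular (W u)) :
    ContDiffAt ℝ k (fun v => rightWeight (W v)) u :=
  have hM := contDiffAt_mat hW
  contDiffAt_matrix_inv (contDiffAt_const.sub
    (contDiffAt_matrix_mul (contDiffAt_matrix_conjTranspose hM) hM)) h.isUnit_det_right

lemma contDiffAt_mixedWeight (hW : ContDiffAt ℝ k W u) (h : Regular (W u)) :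
    ContDiffAt ℝ k (fun v => mixedWeight (W v)) u :=
  contDiffAt_matrix_mul (contDiffAt_matrix_conjTranspose (contDiffAt_mat hW))
    (contDiffAt_leftWeight hW h)

lemma contDiffAt_hermitianForm (hW : ContDiffAt ℝ k W u) (h : Regular (W u))
    (hX : ContDiffAt ℝ k X u) (hY : ContDiffAt ℝ k Y u) :
    ContDiffAt ℝ k (fun v => hermitianForm (W v) (X v) (Y v)) u :=
  contDiffAt_matrix_trace (contDiffAt_matrix_mul (contDiffAt_matrix_mul
    (contDiffAt_matrix_mul (contDiffAt_leftWeight hW h) (contDiffAt_mat hX))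
      (contDiffAt_rightWeight hW h)) (contDiffAt_matrix_conjTranspose (contDiffAt_mat hY)))

lemma contDiffAt_metric (hW : ContDiffAt ℝ k W u) (h : Regular (W u))
    (hX : ContDiffAt ℝ k X u) (hY : ContDiffAt ℝ k Y u) :
    ContDiffAt ℝ k (fun v => metric (W v) (X v) (Y v)) u :=
  Complex.reCLM.contDiff.contDiffAt.comp u (contDiffAt_hermitianForm hW h hX hY)

lemma contDiffAt_christoffelForm (hW : ContDiffAt ℝ k W u) (h : Regular (W u))
    (hX : ContDiffAt ℝ k X u) (hY : ContDiffAt ℝ k Y u) :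
    ContDiffAt ℝ k (fun v => christoffelForm (W v) (X v) (Y v)) u := by
  have hK := contDiffAt_mixedWeight hW h
  have hX := contDiffAt_mat hX
  have hY := contDiffAt_mat hY
  exact (contDiffAt_matrix_mul (contDiffAt_matrix_mul hX hK) hY).add
    (contDiffAt_matrix_mul (contDiffAt_matrix_mul hY hK) hX)

end Smooth

section Derivative

variable {m : ℕ} {t : ℝ} {W X Y : ℝ → Coord m} {W' X' Y' : Coord m}

lemma hasDerivAt_mat (hX : HasDerivAt X X' t) : HasDerivAt (fun s => mat (X s)) (mat X') t := hX

lemma hasDerivAt_vec {F : ℝ → Matrix (Fin 2) (Fin m) ℂ} {F' : Matrix (Fin 2) (Fin m) ℂ}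
    (hF : HasDerivAt F F' t) : HasDerivAt (fun s => vec (F s)) (vec F') t := hF

lemma hasDerivAt_leftWeight (hW : HasDerivAt W W' t) (h : Regular (W t)) :
    HasDerivAt (fun s => leftWeight (W s))
      (leftWeight (W t) * mat W' * mixedWeight (W t)
        + (mixedWeight (W t))ᴴ * (mat W')ᴴ * leftWeight (W t)) t := by
  have hM := hasDerivAt_mat hW
  have hgram := (hasDerivAt_const t 1).sub
    (hasDerivAt_matrix_mul hM (hasDerivAt_matrix_conjTranspose hM))
  convert! hasDerivAt_matrix_inv hgram h using 1
  change _ = -(leftWeight (W t) * _ * leftWeight (W t))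
  rw [conjTranspose_mixedWeight, mixedWeight]
  simp only [zero_sub, Matrix.mul_neg, Matrix.neg_mul, neg_neg, Matrix.mul_add, Matrix.add_mul,
    Matrix.mul_assoc]

lemma hasDerivAt_rightWeight (hW : HasDerivAt W W' t) (h : Regular (W t)) :
    HasDerivAt (fun s => rightWeight (W s))
      (rightWeight (W t) * (mat W')ᴴ * (mixedWeight (W t))ᴴ
        + mixedWeight (W t) * mat W' * rightWeight (W t)) t := by
  have hM := hasDerivAt_mat hW
  have hgram := (hasDerivAt_const t 1).sub
    (hasDerivAt_matrix_mul (hasDerivAt_matrix_conjTranspose hM) hM)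
  convert! hasDerivAt_matrix_inv hgram h.isUnit_det_right using 1
  change _ = -(rightWeight (W t) * _ * rightWeight (W t))
  rw [← h.mul_rightWeight, ← h.rightWeight_mul_conjTranspose]
  simp only [zero_sub, Matrix.mul_neg, Matrix.neg_mul, neg_neg, Matrix.mul_add, Matrix.add_mul,
    Matrix.mul_assoc]

lemma hasDerivAt_mixedWeight (hW : HasDerivAt W W' t) (h : Regular (W t)) :
    HasDerivAt (fun s => mixedWeight (W s))
      (rightWeight (W t) * (mat W')ᴴ * leftWeight (W t)
        + mixedWeight (W t) * mat W' * mixedWeight (W t)) t := by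
  convert! hasDerivAt_matrix_mul (hasDerivAt_matrix_conjTranspose (hasDerivAt_mat hW))
    (hasDerivAt_leftWeight hW h) using 1
  rw [h.rightWeight_eq, conjTranspose_mixedWeight, mixedWeight]
  simp only [Matrix.mul_add, Matrix.add_mul, Matrix.one_mul, Matrix.mul_assoc]
  abel

lemma hasDerivAt_hermitianForm (hW : HasDerivAt W W' t) (h : Regular (W t))
    (hX : HasDerivAt X X' t) (hY : HasDerivAt Y Y' t) :
    HasDerivAt (fun s => hermitianForm (W s) (X s) (Y s))
      (hermitianForm (W t) (X' + christoffelForm (W t) W' (X t)) (Y t)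
        + hermitianForm (W t) (X t) (Y' + christoffelForm (W t) W' (Y t))) t := by
  have hP := hasDerivAt_leftWeight hW h
  have hQ := hasDerivAt_rightWeight hW h
  have hYc := hasDerivAt_matrix_conjTranspose (hasDerivAt_mat hY)
  convert! hasDerivAt_matrix_trace (hasDerivAt_matrix_mul (hasDerivAt_matrix_mul
    (hasDerivAt_matrix_mul hP (hasDerivAt_mat hX)) hQ) hYc) using 1
  rw [hermitianForm_add_left, hermitianForm_add_right]
  set P := leftWeight (W t)
  set Q := rightWeight (W t)
  set K := mixedWeight (W t)
  have hcyclic : (P * mat (X t) * Q * ((mat (Y t))ᴴ * (Kᴴ * (mat W')ᴴ))).trace =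
      (Kᴴ * (mat W')ᴴ * P * mat (X t) * Q * (mat (Y t))ᴴ).trace := by
    rw [← Matrix.mul_assoc _ _ (Kᴴ * (mat W')ᴴ), Matrix.trace_mul_comm]
    simp only [Matrix.mul_assoc]
  simp only [mat] at hcyclic
  simp only [hermitianForm, christoffelForm, mat, vec, Equiv.apply_symm_apply, Matrix.mul_add,
    Matrix.add_mul, Matrix.trace_add, Matrix.conjTranspose_add, Matrix.conjTranspose_mul]
  rw [hcyclic]
  simp only [Matrix.mul_assoc]
  ring

lemma hasDerivAt_christoffelForm (hW : HasDerivAt W W' t) (h : Regular (W t))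
    (hX : HasDerivAt X X' t) (hY : HasDerivAt Y Y' t) :
    HasDerivAt (fun s => christoffelForm (W s) (X s) (Y s))
      (christoffelDeriv (W t) W' (X t) (Y t) + christoffelForm (W t) X' (Y t)
        + christoffelForm (W t) (X t) Y') t := by
  have hK := hasDerivAt_mixedWeight hW h
  have hX := hasDerivAt_mat hX
  have hY := hasDerivAt_mat hY
  convert! hasDerivAt_vec ((hasDerivAt_matrix_mul (hasDerivAt_matrix_mul hX hK) hY).add
    (hasDerivAt_matrix_mul (hasDerivAt_matrix_mul hY hK) hX)) using 1
  apply Matrix.of.injective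
  simp only [christoffelForm, christoffelDeriv, mat, vec, ← Matrix.of_add_of,
    Equiv.apply_symm_apply, Matrix.mul_add, Matrix.add_mul]
  abel

end Derivative

section CovariantDerivative

variable {m : ℕ} {E : Type*} [NormedAddCommGroup E] [NormedSpace ℝ E]
  {f N V V₁ V₂ : E → Coord m} {u : E}

/-- The Levi-Civita derivative `∇_v V` at `u` of a vector field `V` along a map `f` into the
coordinate space. -/
def covDeriv (f V : E → Coord m) (u v : E) : Coord m :=
  fderiv ℝ V u v + christoffelForm (f u) (fderiv ℝ f u v) (V u)

lemma hasDerivAt_metric {W X Y : ℝ → Coord m} {W' X' Y' : Coord m} {t : ℝ}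
    (hW : HasDerivAt W W' t) (h : Regular (W t)) (hX : HasDerivAt X X' t)
    (hY : HasDerivAt Y Y' t) :
    HasDerivAt (fun s => metric (W s) (X s) (Y s))
      (metric (W t) (X' + christoffelForm (W t) W' (X t)) (Y t)
        + metric (W t) (X t) (Y' + christoffelForm (W t) W' (Y t))) t := by
  have hform := hasDerivAt_hermitianForm hW h hX hY
  simpa only [metric_eq_re, Complex.reCLM_apply, Complex.add_re, Function.comp_def] using
    Complex.reCLM.hasFDerivAt.comp_hasDerivAt t hform

lemma differentiableAt_metric (hf : DifferentiableAt ℝ f u) (h : Regular (f u))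
    (h₁ : DifferentiableAt ℝ V₁ u) (h₂ : DifferentiableAt ℝ V₂ u) :
    DifferentiableAt ℝ (fun w => metric (f w) (V₁ w) (V₂ w)) u := by
  have hmetric : ContDiffAt ℝ 1 (fun p : Coord m × Coord m × Coord m => metric p.1 p.2.1 p.2.2)
      (f u, V₁ u, V₂ u) :=
    contDiffAt_metric contDiffAt_fst h (contDiffAt_fst.comp _ contDiffAt_snd)
      (contDiffAt_snd.comp _ contDiffAt_snd)
  have htriple : DifferentiableAt ℝ (fun w => (f w, V₁ w, V₂ w)) u := hf.prodMk (h₁.prodMk h₂)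
  have hcomp := (hmetric.differentiableAt one_ne_zero).comp u htriple
  exact hcomp

lemma fderiv_metric (hf : DifferentiableAt ℝ f u) (h : Regular (f u))
    (h₁ : DifferentiableAt ℝ V₁ u) (h₂ : DifferentiableAt ℝ V₂ u) (v : E) :
    fderiv ℝ (fun w => metric (f w) (V₁ w) (V₂ w)) u v =
      metric (f u) (covDeriv f V₁ u v) (V₂ u) + metric (f u) (V₁ u) (covDeriv f V₂ u v) := by
  have hline := hasDerivAt_metric (hf.hasFDerivAt.hasLineDerivAt v) (by simpa using h)
    (h₁.hasFDerivAt.hasLineDerivAt v) (h₂.hasFDerivAt.hasLineDerivAt v)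
  simpa [covDeriv] using
    ((differentiableAt_metric hf h h₁ h₂).hasFDerivAt.hasLineDerivAt v).unique hline

lemma isChristoffel_christoffelForm {W : Coord m} (h : Regular W) (X Y : Coord m) :
    IsChristoffel W X Y (christoffelForm W X Y) := by
  have hparallel : ∀ X Y U : Coord m, fderiv ℝ (fun W' => metric W' Y U) W X =
      metric W (christoffelForm W X Y) U + metric W Y (christoffelForm W X U) := by
    intro X Y U
    simpa [covDeriv] using fderiv_metric (f := fun w : Coord m => w) (V₁ := fun _ => Y)
      (V₂ := fun _ => U) differentiableAt_id h (differentiableAt_const Y)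
      (differentiableAt_const U) X
  intro U
  rw [hparallel, hparallel, hparallel, christoffelForm_comm W Y X, christoffelForm_comm W U X,
    christoffelForm_comm W U Y, metric_comm W Y, metric_comm W X (christoffelForm W Y U),
    metric_comm W (christoffelForm W X U)]
  ring

lemma christoffel_eq_christoffelForm (p : Space m) (X Y : Coord m) :
    christoffel (coord p) X Y = christoffelForm (coord p) X Y := by
  have hform := isChristoffel_christoffelForm (regular_coord p) X Y
  have hchoice : IsChristoffel (coord p) X Y (christoffel (coord p) X Y) :=
    Classical.epsilon_spec ⟨_, hform⟩
  refine eq_of_metric_eq p fun U => ?_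
  linarith [hform U, hchoice U]

lemma covDeriv_const_smul (c : ℂ) (hV : DifferentiableAt ℝ V u) (v : E) :
    covDeriv f (fun w => c • V w) u v = c • covDeriv f V u v := by
  simp only [covDeriv, fderiv_fun_const_smul hV, christoffelForm_smul_right, smul_add]
  rfl

lemma covDeriv_kaehler (hV : DifferentiableAt ℝ V u) (v : E) :
    covDeriv f (fun w => kaehler (V w)) u v = kaehler (covDeriv f V u v) :=
  covDeriv_const_smul Complex.I hV v

lemma fderiv_fderiv_apply {F : Type*} [NormedAddCommGroup F] [NormedSpace ℝ F] {h : E → F}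
    (hh : ContDiffAt ℝ 2 h u) (v w : E) :
    fderiv ℝ (fun z => fderiv ℝ h z w) u v = fderiv ℝ (fderiv ℝ h) u v w := by
  have hd : DifferentiableAt ℝ (fderiv ℝ h) u :=
    (hh.fderiv_right (m := 1) (by norm_num)).differentiableAt one_ne_zero
  simp [fderiv_clm_apply hd (differentiableAt_const w)]

lemma covDeriv_fderiv_comm (hf : ContDiffAt ℝ 2 f u) (v w : E) :
    covDeriv f (fun z => fderiv ℝ f z w) u v = covDeriv f (fun z => fderiv ℝ f z v) u w := by
  rw [covDeriv, covDeriv, fderiv_fderiv_apply hf, fderiv_fderiv_apply hf, christoffelForm_comm,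
    (hf.isSymmSndFDerivAt (by simp)).eq v w]

lemma contDiffAt_covDeriv {k k' : WithTop ℕ∞} (hk : k + 1 ≤ k') (hf : ContDiffAt ℝ k' f u)
    (h : Regular (f u)) (hV : ContDiffAt ℝ k' V u) {ξ : E → E} (hξ : ContDiffAt ℝ k ξ u) :
    ContDiffAt ℝ k (fun z => covDeriv f V z (ξ z)) u := by
  have hk' : k ≤ k' := le_self_add.trans hk
  exact ((hV.fderiv_right hk).clm_apply hξ).add (contDiffAt_christoffelForm
    (hf.of_le hk') h ((hf.fderiv_right hk).clm_apply hξ) (hV.of_le hk'))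

/-- The curvature tensor `R(X, Y) Z` of the metric at `W`, in closed form. -/
def curvature (W X Y Z : Coord m) : Coord m :=
  vec ((mat Y * rightWeight W * (mat X)ᴴ - mat X * rightWeight W * (mat Y)ᴴ)
      * leftWeight W * mat Z
    + mat Z * rightWeight W
      * ((mat X)ᴴ * leftWeight W * mat Y - (mat Y)ᴴ * leftWeight W * mat X))

lemma curvature_eq (W X Y Z : Coord m) :
    curvature W X Y Z = christoffelDeriv W X Y Z - christoffelDeriv W Y X Z
      + christoffelForm W X (christoffelForm W Y Z)
      - christoffelForm W Y (christoffelForm W X Z) := by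
  apply Matrix.of.injective
  simp only [christoffelForm, christoffelDeriv, curvature, mat, vec, ← Matrix.of_add_of,
    ← Matrix.of_sub_of, Equiv.apply_symm_apply, Matrix.mul_add, Matrix.add_mul, Matrix.mul_sub,
    Matrix.sub_mul, Matrix.mul_assoc]
  abel

lemma fderiv_covDeriv (hf : ContDiffAt ℝ 2 f u) (h : Regular (f u)) (hV : ContDiffAt ℝ 2 V u)
    (v w : E) :
    fderiv ℝ (fun z => covDeriv f V z w) u v =
      fderiv ℝ (fderiv ℝ V) u v w
        + (christoffelDeriv (f u) (fderiv ℝ f u v) (fderiv ℝ f u w) (V u)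
          + christoffelForm (f u) (fderiv ℝ (fderiv ℝ f) u v w) (V u)
          + christoffelForm (f u) (fderiv ℝ f u w) (fderiv ℝ V u v)) := by
  have hline : ∀ {g : E → Coord m}, ContDiffAt ℝ 2 g u →
      HasDerivAt (fun s : ℝ => fderiv ℝ g (u + s • v) w) (fderiv ℝ (fderiv ℝ g) u v w) 0 := by
    intro g hg
    rw [← fderiv_fderiv_apply hg]
    exact (((hg.fderiv_right (m := 1) (by norm_num)).differentiableAt one_ne_zero).clm_apply
      (differentiableAt_const w)).hasFDerivAt.hasLineDerivAt v
  have hΓ := hasDerivAt_christoffelForm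
    ((hf.differentiableAt two_ne_zero).hasFDerivAt.hasLineDerivAt v) (by simpa using h)
    (hline hf) ((hV.differentiableAt two_ne_zero).hasFDerivAt.hasLineDerivAt v)
  have hcov : DifferentiableAt ℝ (fun z => covDeriv f V z w) u :=
    (contDiffAt_covDeriv (k := 1) (by norm_num) hf h hV contDiffAt_const).differentiableAt
      one_ne_zero
  simpa using (hcov.hasFDerivAt.hasLineDerivAt v).unique ((hline hV).add hΓ)

lemma covDeriv_covDeriv_sub (hf : ContDiffAt ℝ 2 f u) (h : Regular (f u))
    (hV : ContDiffAt ℝ 2 V u) (v w : E) :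
    covDeriv f (fun z => covDeriv f V z w) u v - covDeriv f (fun z => covDeriv f V z v) u w =
      curvature (f u) (fderiv ℝ f u v) (fderiv ℝ f u w) (V u) := by
  have hexpand : ∀ v w, covDeriv f (fun z => covDeriv f V z w) u v =
      fderiv ℝ (fderiv ℝ V) u v w
        + (christoffelDeriv (f u) (fderiv ℝ f u v) (fderiv ℝ f u w) (V u)
          + christoffelForm (f u) (fderiv ℝ (fderiv ℝ f) u v w) (V u)
          + christoffelForm (f u) (fderiv ℝ f u w) (fderiv ℝ V u v))
        + (christoffelForm (f u) (fderiv ℝ f u v) (fderiv ℝ V u w)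
          + christoffelForm (f u) (fderiv ℝ f u v)
            (christoffelForm (f u) (fderiv ℝ f u w) (V u))) := by
    intro v w
    rw [covDeriv, fderiv_covDeriv hf h hV, covDeriv, christoffelForm_add_right]
  rw [hexpand v w, hexpand w v, (hV.isSymmSndFDerivAt (by simp)).eq v w,
    (hf.isSymmSndFDerivAt (by simp)).eq v w, curvature_eq]
  abel

section ReebForm

variable {α : E → ℝ}

/- The hypothesis says `A ξ = α ξ` in the form `g(A X, ξ) = α η(X)`: if `N` is the unit normal field
of the hypersurface `f` and `ξ = -J N`, then its left-hand side is `g(A w, ξ)`. -/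
lemma metric_covDeriv_covDeriv_kaehler (hf : ContDiffAt ℝ 2 f u) (h : Regular (f u))
    (hN : ContDiffAt ℝ 2 N u) (hα : DifferentiableAt ℝ α u) {w : E}
    (hω : ∀ᶠ z in nhds u, metric (f z) (covDeriv f N z w) (kaehler (N z)) =
      α z * -metric (f z) (fderiv ℝ f z w) (kaehler (N z))) (v : E) :
    metric (f u) (covDeriv f (fun z => covDeriv f N z w) u v) (kaehler (N u))
        + metric (f u) (covDeriv f N u w) (kaehler (covDeriv f N u v)) =
      fderiv ℝ α u v * -metric (f u) (fderiv ℝ f u w) (kaehler (N u))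
        - α u * (metric (f u) (covDeriv f (fun z => fderiv ℝ f z w) u v) (kaehler (N u))
          + metric (f u) (fderiv ℝ f u w) (kaehler (covDeriv f N u v))) := by
  have hf' := hf.differentiableAt two_ne_zero
  have hN' := hN.differentiableAt two_ne_zero
  have hJN : DifferentiableAt ℝ (fun z => kaehler (N z)) u := hN'.const_smul Complex.I
  have hfw : DifferentiableAt ℝ (fun z => fderiv ℝ f z w) u :=
    ((hf.fderiv_right (m := 1) (by norm_num)).differentiableAt one_ne_zero).clm_apply
      (differentiableAt_const w)
  have hcov : DifferentiableAt ℝ (fun z => covDeriv f N z w) u :=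
    (contDiffAt_covDeriv (k := 1) (by norm_num) hf h hN contDiffAt_const).differentiableAt
      one_ne_zero
  have hderiv := DFunLike.congr_fun (Filter.EventuallyEq.fderiv_eq (𝕜 := ℝ) hω) v
  rw [fderiv_metric hf' h hcov hJN, covDeriv_kaehler hN',
    fderiv_fun_mul hα (differentiableAt_metric hf' h hfw hJN).fun_neg, fderiv_fun_neg] at hderiv
  simp only [add_apply, smul_apply, neg_apply, smul_eq_mul] at hderiv
  rw [fderiv_metric hf' h hfw hJN, covDeriv_kaehler hN'] at hderiv
  linarith

lemma metric_curvature_kaehler (hf : ContDiffAt ℝ 2 f u) (h : Regular (f u))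
    (hN : ContDiffAt ℝ 2 N u) (hα : DifferentiableAt ℝ α u)
    (hω : ∀ᶠ z in nhds u, ∀ w, metric (f z) (covDeriv f N z w) (kaehler (N z)) =
      α z * -metric (f z) (fderiv ℝ f z w) (kaehler (N z))) (v w : E) :
    metric (f u) (curvature (f u) (fderiv ℝ f u v) (fderiv ℝ f u w) (N u)) (kaehler (N u))
        + 2 * metric (f u) (covDeriv f N u w) (kaehler (covDeriv f N u v)) =
      fderiv ℝ α u v * -metric (f u) (fderiv ℝ f u w) (kaehler (N u))
        - fderiv ℝ α u w * -metric (f u) (fderiv ℝ f u v) (kaehler (N u))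
        + α u * (metric (f u) (fderiv ℝ f u v) (kaehler (covDeriv f N u w))
          - metric (f u) (fderiv ℝ f u w) (kaehler (covDeriv f N u v))) := by
  have hvw := metric_covDeriv_covDeriv_kaehler hf h hN hα (hω.mono fun z hz => hz w) v
  have hwv := metric_covDeriv_covDeriv_kaehler hf h hN hα (hω.mono fun z hz => hz v) w
  have hskew : metric (f u) (covDeriv f N u v) (kaehler (covDeriv f N u w)) =
      -metric (f u) (covDeriv f N u w) (kaehler (covDeriv f N u v)) := by
    rw [metric_comm, metric_kaehler_left]
  rw [covDeriv_fderiv_comm hf v w] at hvw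
  rw [hskew] at hwv
  rw [← covDeriv_covDeriv_sub hf h hN v w, metric_sub_left]
  linarith

end ReebForm

end CovariantDerivative

section QuaternionTriple

/-- Traceless `2 × 2` matrices `q₀, q₁, q₂` (indices modulo 3) satisfying the relations of the
imaginary quaternions. -/
structure IsQuaternionTriple (q : Fin 3 → Matrix (Fin 2) (Fin 2) ℂ) : Prop where
  trace : ∀ ν, (q ν).trace = 0
  sq : ∀ ν, q ν * q ν = -1
  mul : ∀ ν, q ν * q (ν + 1) = q (ν + 2)

variable {q : Fin 3 → Matrix (Fin 2) (Fin 2) ℂ}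

namespace IsQuaternionTriple

lemma trace_mul (hq : IsQuaternionTriple q) (μ ν : Fin 3) :
    (q μ * q ν).trace = if μ = ν then -2 else 0 := by
  have hcases : μ = ν ∨ ν = μ + 1 ∨ μ = ν + 1 := by revert μ ν; decide
  rcases hcases with rfl | rfl | rfl
  · simp [hq.sq]
  · simp [hq.mul, hq.trace]
  · rw [Matrix.trace_mul_comm]
    simp [hq.mul, hq.trace]

/- The traces against `1, q₀, q₁, q₂` determine a matrix: they map the four-dimensional space of
matrices onto `ℂ⁴`, because these four matrices are orthogonal for the trace form. -/
lemma eq_of_trace_eq (hq : IsQuaternionTriple q) {A B : Matrix (Fin 2) (Fin 2) ℂ}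
    (htr : A.trace = B.trace) (hqtr : ∀ ν, (q ν * A).trace = (q ν * B).trace) : A = B := by
  let traces : Matrix (Fin 2) (Fin 2) ℂ →ₗ[ℂ] ℂ × (Fin 3 → ℂ) :=
    (Matrix.traceLinearMap (Fin 2) ℂ ℂ).prod
      (LinearMap.pi fun ν => Matrix.traceLinearMap (Fin 2) ℂ ℂ ∘ₗ LinearMap.mulLeft ℂ (q ν))
  have hsurj : Function.Surjective traces := by
    rintro ⟨c, d⟩
    refine ⟨(c / 2) • 1 - ∑ ν, (d ν / 2) • q ν, ?_⟩
    ext ν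
    · simp [traces, Matrix.trace_sum, hq.trace]
    · simp [traces, Matrix.trace_sum, hq.trace, hq.trace_mul]
  have hinj : Function.Injective traces :=
    (LinearMap.injective_iff_surjective_of_finrank_eq_finrank
      (by simp [Module.finrank_matrix])).2 hsurj
  exact hinj (Prod.ext htr (funext hqtr))

lemma expansion (hq : IsQuaternionTriple q) (A : Matrix (Fin 2) (Fin 2) ℂ) :
    A = (A.trace / 2) • 1 - ∑ ν, ((q ν * A).trace / 2) • q ν := by
  apply hq.eq_of_trace_eq
  · simp [Matrix.trace_sum, hq.trace]
  · intro μ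
    simp [mul_sub, Finset.mul_sum, Matrix.trace_sum, hq.trace, hq.trace_mul]

lemma sum_trace_mul_trace (hq : IsQuaternionTriple q) (A B : Matrix (Fin 2) (Fin 2) ℂ) :
    ∑ ν, (q ν * A).trace * (q ν * B).trace = A.trace * B.trace - 2 * (A * B).trace := by
  have htrace : (A * B).trace =
      A.trace * B.trace / 2 - ∑ ν, (q ν * A).trace / 2 * (q ν * B).trace := by
    conv_lhs => rw [hq.expansion A]
    simp [sub_mul, Finset.sum_mul, Matrix.trace_sum, div_mul_eq_mul_div]
  rw [htrace, mul_sub, Finset.mul_sum, mul_div_cancel₀ _ two_ne_zero, sub_sub_cancel]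
  exact Finset.sum_congr rfl fun ν _ => by ring

end IsQuaternionTriple

end QuaternionTriple

section NormalCurvature

variable {m : ℕ}

/-- The `2 × 2` matrix `X (1 - Wᴴ W)⁻¹ Yᴴ (1 - W Wᴴ)⁻¹`, whose trace is the Hermitian form. -/
def formMatrix (W X Y : Coord m) : Matrix (Fin 2) (Fin 2) ℂ :=
  mat X * rightWeight W * (mat Y)ᴴ * leftWeight W

/-- The quartic invariant `tr (X Yᴴ Z Vᴴ)` of the isotropy representation, transported to `W`. -/
def quartic (W X Y Z V : Coord m) : ℂ := (formMatrix W X Y * formMatrix W Z V).trace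

lemma trace_formMatrix (W X Y : Coord m) : (formMatrix W X Y).trace = hermitianForm W X Y := by
  rw [formMatrix, Matrix.trace_mul_comm, hermitianForm]
  simp only [Matrix.mul_assoc]

lemma quartic_comm (W X Y Z V : Coord m) : quartic W X Y Z V = quartic W Z V X Y :=
  Matrix.trace_mul_comm _ _

lemma conjTranspose_formMatrix (W X Y : Coord m) :
    (formMatrix W X Y)ᴴ = leftWeight W * (mat Y * rightWeight W * (mat X)ᴴ) := by
  simp only [formMatrix, Matrix.conjTranspose_mul, Matrix.conjTranspose_conjTranspose,
    conjTranspose_leftWeight, conjTranspose_rightWeight, Matrix.mul_assoc]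

lemma star_quartic (W X Y Z V : Coord m) : star (quartic W X Y Z V) = quartic W Y X V Z := by
  rw [quartic, ← Matrix.trace_conjTranspose, Matrix.conjTranspose_mul, conjTranspose_formMatrix,
    conjTranspose_formMatrix, Matrix.mul_assoc, Matrix.trace_mul_comm, quartic_comm, quartic]
  simp only [formMatrix, Matrix.mul_assoc]

lemma quartic_smul_left (W : Coord m) (c : ℂ) (X Y Z V : Coord m) :
    quartic W (c • X) Y Z V = c * quartic W X Y Z V := by
  simp only [quartic, formMatrix, mat, ← Matrix.smul_of, Matrix.smul_mul, Matrix.trace_smul,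
    smul_eq_mul]

lemma hermitianForm_curvature (W X Y Z V : Coord m) :
    hermitianForm W (curvature W X Y Z) V = quartic W Y X Z V - quartic W X Y Z V
      + quartic W Z X Y V - quartic W Z Y X V := by
  simp only [← trace_formMatrix, quartic, ← Matrix.trace_add, ← Matrix.trace_sub]
  congr 1
  simp only [formMatrix, curvature, mat, vec, Equiv.apply_symm_apply, Matrix.add_mul,
    Matrix.mul_sub, Matrix.sub_mul, Matrix.mul_assoc]
  abel

/-- The component `⟨R(X, Y) N, J N⟩` of the curvature tensor; for a unit normal vector `N` it is the
`ξ`-component of the right-hand side of the Codazzi equation. -/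
def normalCurvature (W N X Y : Coord m) : ℝ := metric W (curvature W X Y N) (kaehler N)

lemma normalCurvature_eq (W N X Y : Coord m) :
    normalCurvature W N X Y = -2 * (quartic W X Y N N).im - 2 * (quartic W X N N Y).im := by
  rw [normalCurvature, metric_eq_re, kaehler_apply, hermitianForm_smul_right,
    hermitianForm_curvature, quartic_comm W N Y X N,
    ← star_quartic W X Y N N, ← star_quartic W X N N Y]
  simp only [RCLike.star_def, Complex.conj_I, neg_mul, Complex.neg_re, Complex.I_mul_re,
    Complex.add_im, Complex.sub_im, Complex.conj_im]
  ring

lemma normalCurvature_reeb (W N Y : Coord m) :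
    normalCurvature W N (-kaehler N) Y = 4 * (quartic W Y N N N).re := by
  have hreeb : -kaehler N = (-Complex.I) • N := by rw [neg_smul, kaehler_apply]
  rw [normalCurvature_eq, hreeb, quartic_smul_left, quartic_smul_left, quartic_comm W N N N Y,
    ← star_quartic W Y N N N, ← star_quartic W N Y N N, star_quartic W N Y N N]
  simp only [RCLike.star_def, neg_mul, Complex.neg_im, Complex.I_mul_im, Complex.conj_re]
  ring

end NormalCurvature

section Quaternionic

variable {m : ℕ} {p : Space m} {T : Coord m →ₗ[ℝ] Coord m} {X N : Coord m}

lemma metric_kaehler_eq_neg_im (W X Y : Coord m) :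
    metric W (kaehler X) Y = -(hermitianForm W X Y).im := by
  rw [metric_eq_re, kaehler_apply, hermitianForm_smul_left, Complex.I_mul_re]

lemma hermitianForm_self_of_metric_eq_one {W : Coord m} (hN : metric W N N = 1) :
    hermitianForm W N N = 1 :=
  Complex.ext hN (Complex.conj_eq_iff_im.1 (star_hermitianForm W N N))

lemma exists_matrix_of_mem_quaternionic (hT : T ∈ quaternionic p) :
    ∃ q : Matrix (Fin 2) (Fin 2) ℂ, q.trace = 0 ∧
      qᴴ * leftWeight (coord p) = -(leftWeight (coord p) * q) ∧
      ∀ X, mat (T X) = q * mat X := by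
  obtain ⟨g, rfl, q, hq, htr, hTq⟩ := hT
  have hweight : leftWeight (coord (g : Space m)) = blockA g * (blockA g)ᴴ :=
    (one_sub_coord_mul g).1
  have hA : IsUnit (blockA g).det := (Matrix.isUnit_iff_isUnit_det _).1 (isUnit_blockA g)
  have hAH : IsUnit ((blockA g)ᴴ).det :=
    (Matrix.isUnit_iff_isUnit_det _).1 (isUnit_blockA g).star
  refine ⟨((blockA g)ᴴ)⁻¹ * q * (blockA g)ᴴ, ?_, ?_, fun X => ?_⟩
  · rw [Matrix.trace_mul_comm, Matrix.mul_nonsing_inv_cancel_left _ _ hAH, htr]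
  · simp only [hweight, Matrix.conjTranspose_mul, Matrix.conjTranspose_nonsing_inv,
      Matrix.conjTranspose_conjTranspose, hq, Matrix.mul_assoc]
    rw [Matrix.nonsing_inv_mul_cancel_left _ _ hA, Matrix.mul_nonsing_inv_cancel_left _ _ hAH]
    simp only [Matrix.neg_mul, Matrix.mul_neg]
  · obtain ⟨Y, rfl⟩ : ∃ Y, translate g Y = X := ⟨_, translate_vec g X⟩
    rw [hTq, mat_translate, mat_translate, mat, vec, Equiv.apply_symm_apply]
    simp only [Matrix.mul_assoc]
    rw [Matrix.mul_nonsing_inv_cancel_left _ _ hAH]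

lemma hermitianForm_left_mul {W X X' : Coord m} {q : Matrix (Fin 2) (Fin 2) ℂ}
    (h : mat X' = q * mat X) (Y : Coord m) :
    hermitianForm W X' Y = (q * formMatrix W X Y).trace := by
  rw [← trace_formMatrix, formMatrix, h, formMatrix]
  simp only [Matrix.mul_assoc]

lemma hermitianForm_quaternionic (hT : T ∈ quaternionic p) (X Y : Coord m) :
    hermitianForm (coord p) (T X) Y = -hermitianForm (coord p) X (T Y) := by
  obtain ⟨q, -, hskew, hq⟩ := exists_matrix_of_mem_quaternionic hT
  rw [hermitianForm_left_mul (hq X), ← trace_formMatrix, formMatrix, formMatrix, hq Y,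
    Matrix.conjTranspose_mul, ← Matrix.mul_assoc _ _ qᴴ, Matrix.mul_assoc _ qᴴ, hskew,
    Matrix.trace_mul_comm]
  simp only [Matrix.mul_assoc, Matrix.mul_neg, Matrix.trace_neg, neg_neg]

lemma quaternionic_kaehler (hT : T ∈ quaternionic p) (X : Coord m) :
    T (kaehler X) = kaehler (T X) := by
  obtain ⟨q, -, -, hq⟩ := exists_matrix_of_mem_quaternionic hT
  apply Matrix.of.injective
  rw [← mat, hq, kaehler_apply, kaehler_apply, mat, ← Matrix.smul_of, ← Matrix.smul_of,
    Matrix.mul_smul, ← mat, ← hq]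

lemma hermitianForm_quaternionic_comm (hT : T ∈ quaternionic p) (X N : Coord m) :
    hermitianForm (coord p) (T N) X = -star (hermitianForm (coord p) (T X) N) := by
  rw [hermitianForm_quaternionic hT, star_hermitianForm]

lemma metric_quaternionic_self (hT : T ∈ quaternionic p) (N : Coord m) :
    metric (coord p) (T N) N = 0 := by
  have hre := congrArg Complex.re (hermitianForm_quaternionic_comm hT N N)
  rw [Complex.neg_re, Complex.star_def, Complex.conj_re] at hre
  rw [metric_eq_re]
  linarith

lemma eq_of_mul_mat_eq (hm : 0 < m) {a b : Matrix (Fin 2) (Fin 2) ℂ}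
    (h : ∀ X : Coord m, a * mat X = b * mat X) : a = b := by
  ext i j
  have hentry := congrFun (congrFun (h (vec (Matrix.single j ⟨0, hm⟩ 1))) i) ⟨0, hm⟩
  simpa only [mat, vec, Equiv.apply_symm_apply, Matrix.mul_single_apply_same, mul_one] using hentry

namespace IsCanonicalBasis

variable {Jq : Fin 3 → Coord m →ₗ[ℝ] Coord m}

lemma exists_quaternionTriple (hm : 0 < m) (hJ : IsCanonicalBasis p Jq) :
    ∃ q, IsQuaternionTriple q ∧ ∀ ν X, mat (Jq ν X) = q ν * mat X := by
  choose q htr _ hq using fun ν => exists_matrix_of_mem_quaternionic (hJ.mem ν)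
  refine ⟨q, ⟨htr, fun ν => ?_, fun ν => ?_⟩, hq⟩
  · refine eq_of_mul_mat_eq hm fun X => ?_
    rw [Matrix.mul_assoc, ← hq, ← hq, hJ.sq, Matrix.neg_mul, Matrix.one_mul]
    exact Matrix.neg_of X
  · refine eq_of_mul_mat_eq hm fun X => ?_
    rw [Matrix.mul_assoc, ← hq, ← hq, hJ.mul, hq]

lemma sum_hermitianForm_mul (hJ : IsCanonicalBasis p Jq) (X Y Z V : Coord m) :
    ∑ ν, hermitianForm (coord p) (Jq ν X) Y * hermitianForm (coord p) (Jq ν Z) V =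
      hermitianForm (coord p) X Y * hermitianForm (coord p) Z V
        - 2 * quartic (coord p) X Y Z V := by
  obtain rfl | hm := m.eq_zero_or_pos
  · simp [hermitianForm, quartic, formMatrix, Subsingleton.elim _ (0 : Coord 0)]
  obtain ⟨q, hq, hmat⟩ := hJ.exists_quaternionTriple hm
  simp only [hermitianForm_left_mul (hmat _ _), hq.sum_trace_mul_trace, trace_formMatrix, quartic]

lemma sum_im_mul_re_sub (hJ : IsCanonicalBasis p Jq) (X Y N : Coord m) :
    ∑ ν, ((hermitianForm (coord p) (Jq ν X) N).im * (hermitianForm (coord p) (Jq ν Y) N).re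
        - (hermitianForm (coord p) (Jq ν X) N).re * (hermitianForm (coord p) (Jq ν Y) N).im) =
      2 * (quartic (coord p) X N N Y).im
        - (hermitianForm (coord p) X N * hermitianForm (coord p) N Y).im := by
  calc _ = -(∑ ν, hermitianForm (coord p) (Jq ν X) N * hermitianForm (coord p) (Jq ν N) Y).im := by
        rw [Complex.im_sum, ← Finset.sum_neg_distrib]
        refine Finset.sum_congr rfl fun ν _ => ?_
        rw [hermitianForm_quaternionic_comm (hJ.mem ν) Y N]
        simp only [Complex.mul_im, Complex.neg_re, Complex.neg_im, Complex.star_def,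
          Complex.conj_re, Complex.conj_im]
        ring
    _ = _ := by
        rw [hJ.sum_hermitianForm_mul, Complex.sub_im, neg_sub, ← Complex.ofReal_ofNat,
          Complex.im_ofReal_mul]

lemma sum_re_mul_im (hJ : IsCanonicalBasis p Jq) (X Y : Coord m) {N : Coord m}
    (hN : metric (coord p) N N = 1) :
    ∑ ν, (hermitianForm (coord p) (Jq ν X) Y).re * (hermitianForm (coord p) (Jq ν N) N).im =
      (hermitianForm (coord p) X Y).im - 2 * (quartic (coord p) X Y N N).im := by
  have him := congrArg Complex.im (hJ.sum_hermitianForm_mul X Y N N)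
  rw [hermitianForm_self_of_metric_eq_one hN, mul_one, Complex.sub_im, ← Complex.ofReal_ofNat,
    Complex.im_ofReal_mul, Complex.im_sum] at him
  simpa only [Complex.mul_im, ← metric_eq_re _ (Jq _ N), metric_quaternionic_self (hJ.mem _),
    mul_zero, add_zero] using him

lemma sum_im_mul_im (hJ : IsCanonicalBasis p Jq) (X : Coord m) {N : Coord m}
    (hN : metric (coord p) N N = 1) :
    ∑ ν, (hermitianForm (coord p) (Jq ν X) N).im * (hermitianForm (coord p) (Jq ν N) N).im =
      2 * (quartic (coord p) X N N N).re - metric (coord p) X N := by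
  have hre := congrArg Complex.re (hJ.sum_hermitianForm_mul X N N N)
  rw [hermitianForm_self_of_metric_eq_one hN, mul_one, Complex.sub_re, ← Complex.ofReal_ofNat,
    Complex.re_ofReal_mul, Complex.re_sum] at hre
  simp only [Complex.mul_re, ← metric_eq_re, metric_quaternionic_self (hJ.mem _), mul_zero,
    zero_sub, Finset.sum_neg_distrib] at hre
  linarith

end IsCanonicalBasis

end Quaternionic

/-! ### Functions and vector fields in a chart of a manifold -/

section ManifoldChart

variable {n : ℕ} {M : Type*} [TopologicalSpace M] [ChartedSpace (EuclideanSpace ℝ (Fin n)) M]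
  {F : Type*} [NormedAddCommGroup F] [NormedSpace ℝ F] {x : M} {u : EuclideanSpace ℝ (Fin n)}
  {h : M → F} {k : WithTop ℕ∞}

lemma contMDiffAt_of_comp_chart
    (hh : ContDiffAt ℝ k (fun z => h ((extChartAt (𝓡 n) x).symm z)) (extChartAt (𝓡 n) x x)) :
    ContMDiffAt (𝓡 n) 𝓘(ℝ, F) k h x :=
  contMDiffAt_iff_source.2 hh.contMDiffAt.contMDiffWithinAt

lemma mvfderiv_eq_fderiv_comp_chart (hh : MDifferentiableAt (𝓡 n) 𝓘(ℝ, F) h x)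
    (X : TangentSpace (𝓡 n) x) :
    mvfderiv (𝓡 n) h x X =
      fderiv ℝ (fun z => h ((extChartAt (𝓡 n) x).symm z)) (extChartAt (𝓡 n) x x) X := by
  have hwritten : mfderiv (𝓡 n) 𝓘(ℝ, F) h x =
      fderivWithin ℝ (fun z => h ((extChartAt (𝓡 n) x).symm z)) (Set.range (𝓡 n))
        (extChartAt (𝓡 n) x x) := hh.mfderiv
  rw [(𝓡 n).range_eq_univ, fderivWithin_univ] at hwritten
  exact DFunLike.congr_fun hwritten X

variable [IsManifold (𝓡 n) ∞ M]

/-- The derivative at `u` of the inverse of the chart at `x`. -/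
def chartDeriv (x : M) (u : EuclideanSpace ℝ (Fin n)) :
    EuclideanSpace ℝ (Fin n) →L[ℝ] TangentSpace (𝓡 n) ((extChartAt (𝓡 n) x).symm u) :=
  mfderivWithin 𝓘(ℝ, EuclideanSpace ℝ (Fin n)) (𝓡 n) (extChartAt (𝓡 n) x).symm
    (Set.range (𝓡 n)) u

/-- The representation in the chart at `x` of a vector field. -/
def chartField (x : M) (V : Π y : M, TangentSpace (𝓡 n) y) (u : EuclideanSpace ℝ (Fin n)) :
    EuclideanSpace ℝ (Fin n) :=
  (chartDeriv x u).inverse (V ((extChartAt (𝓡 n) x).symm u))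

lemma fderiv_comp_chart (hu : u ∈ (extChartAt (𝓡 n) x).target)
    (hh : MDifferentiableAt (𝓡 n) 𝓘(ℝ, F) h ((extChartAt (𝓡 n) x).symm u))
    (v : EuclideanSpace ℝ (Fin n)) :
    fderiv ℝ (fun z => h ((extChartAt (𝓡 n) x).symm z)) u v =
      mvfderiv (𝓡 n) h ((extChartAt (𝓡 n) x).symm u) (chartDeriv x u v) := by
  have hcomp : mfderivWithin 𝓘(ℝ, EuclideanSpace ℝ (Fin n)) 𝓘(ℝ, F)
      (h ∘ (extChartAt (𝓡 n) x).symm) (Set.range (𝓡 n)) u =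
        mfderiv (𝓡 n) 𝓘(ℝ, F) h ((extChartAt (𝓡 n) x).symm u) ∘SL chartDeriv x u :=
    mfderiv_comp_mfderivWithin u hh (mdifferentiableWithinAt_extChartAt_symm hu)
      ((𝓡 n).uniqueMDiffOn u (extChartAt_target_subset_range x hu))
  rw [mfderivWithin_eq_fderivWithin, (𝓡 n).range_eq_univ, fderivWithin_univ] at hcomp
  exact DFunLike.congr_fun hcomp v

lemma contDiffAt_comp_chart (hk : k ≤ ∞) (hh : ContMDiffAt (𝓡 n) 𝓘(ℝ, F) k h x) :
    ContDiffAt ℝ k (fun z => h ((extChartAt (𝓡 n) x).symm z)) (extChartAt (𝓡 n) x x) := by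
  have hsymm : ContMDiffAt 𝓘(ℝ, EuclideanSpace ℝ (Fin n)) (𝓡 n) ∞ (extChartAt (𝓡 n) x).symm
      (extChartAt (𝓡 n) x x) :=
    (contMDiffOn_extChartAt_symm x).contMDiffAt (extChartAt_target_mem_nhds x)
  rw [← extChartAt_to_inv (I := 𝓡 n) x] at hh
  exact (hh.comp _ (hsymm.of_le hk)).contDiffAt

lemma chartDeriv_chartField (V : Π y : M, TangentSpace (𝓡 n) y)
    (hu : u ∈ (extChartAt (𝓡 n) x).target) :
    chartDeriv x u (chartField x V u) = V ((extChartAt (𝓡 n) x).symm u) := by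
  obtain ⟨e, he⟩ : (chartDeriv x u).IsInvertible := isInvertible_mfderivWithin_extChartAt_symm hu
  rw [chartField, ← he, ContinuousLinearMap.inverse_equiv]
  exact e.apply_symm_apply _

lemma chartField_self (V : Π y : M, TangentSpace (𝓡 n) y) :
    chartField x V (extChartAt (𝓡 n) x x) = V x := by
  have hinv : ∀ v : EuclideanSpace ℝ (Fin n),
      (chartDeriv x (extChartAt (𝓡 n) x x)).inverse v = v :=
    mfderivWithin_extChartAt_symm_inverse_apply
  have hpoint : ∀ y, y = x → (V y : EuclideanSpace ℝ (Fin n)) = V x := by rintro _ rfl; rfl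
  exact (hinv _).trans (hpoint _ (extChartAt_to_inv x))

lemma contDiffAt_chartField {V : Π y : M, TangentSpace (𝓡 n) y}
    (hV : ContMDiffAt (𝓡 n) (𝓡 n).tangent 1
      (fun y => (⟨y, V y⟩ : TangentBundle (𝓡 n) M)) x) :
    ContDiffAt ℝ 1 (chartField x V) (extChartAt (𝓡 n) x x) := by
  have hpull := VectorField.contMDiffWithinAt_mpullbackWithin_extChartAt_symm (n := ∞) (m := 1)
    (s := Set.univ) (V := V) hV.contMDiffWithinAt uniqueMDiffOn_univ
    (Set.mem_univ x) (by norm_num; exact WithTop.coe_le_coe.2 (le_top : (2 : ℕ∞) ≤ ⊤))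
  rw [contMDiffWithinAt_vectorSpace_iff_contDiffWithinAt, Set.preimage_univ,
    Set.inter_univ] at hpull
  exact hpull.contDiffAt (extChartAt_target_mem_nhds x)

lemma mlieBracket_eq_lieBracket_chartField (V W : Π y : M, TangentSpace (𝓡 n) y) :
    VectorField.mlieBracket (𝓡 n) V W x =
      VectorField.lieBracket ℝ (E := EuclideanSpace ℝ (Fin n)) (chartField x V) (chartField x W)
        (extChartAt (𝓡 n) x x) := by
  have hbracket : VectorField.mlieBracket (𝓡 n) V W x =
      (mfderiv (𝓡 n) 𝓘(ℝ, EuclideanSpace ℝ (Fin n)) (extChartAt (𝓡 n) x) x).inverse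
        (VectorField.lieBracketWithin ℝ (E := EuclideanSpace ℝ (Fin n)) (chartField x V)
          (chartField x W) ((extChartAt (𝓡 n) x).symm ⁻¹' Set.univ ∩ Set.range (𝓡 n))
          (extChartAt (𝓡 n) x x)) :=
    VectorField.mlieBracketWithin_apply
  rw [mfderiv_extChartAt_self, Set.preimage_univ, Set.univ_inter, (𝓡 n).range_eq_univ,
    VectorField.lieBracketWithin_univ] at hbracket
  exact hbracket.trans (DFunLike.congr_fun
    (ContinuousLinearMap.inverse_id (R := ℝ) (M := EuclideanSpace ℝ (Fin n))) _)

end ManifoldChart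

lemma contDiffAt_of_clm_apply_eq {E F : Type*} [NormedAddCommGroup E] [NormedSpace ℝ E]
    [FiniteDimensional ℝ E] [NormedAddCommGroup F] [NormedSpace ℝ F] [FiniteDimensional ℝ F]
    {n : WithTop ℕ∞} {L : E → E →L[ℝ] F} {b : E → F} {ξ : E → E} {u : E}
    (hL : ContDiffAt ℝ n L u) (hb : ContDiffAt ℝ n b u) (hinj : Function.Injective (L u))
    (h : ∀ᶠ z in nhds u, L z (ξ z) = b z) : ContDiffAt ℝ n ξ u := by
  have : CompleteSpace E := FiniteDimensional.complete ℝ E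
  obtain ⟨R, hR⟩ := (L u).toLinearMap.exists_leftInverse_of_injective
    (LinearMap.ker_eq_bot.2 hinj)
  let R' : F →L[ℝ] E := LinearMap.toContinuousLinearMap R
  have hT : ContDiffAt ℝ n (fun z => R' ∘L L z) u := contDiffAt_const.clm_comp hL
  have hTu : R' ∘L L u = (ContinuousLinearEquiv.refl ℝ E : E →L[ℝ] E) := by
    ext v
    exact DFunLike.congr_fun hR v
  have hinv : ContDiffAt ℝ n (fun z => (R' ∘L L z).inverse) u := by
    refine ContDiffAt.comp u (g := ContinuousLinearMap.inverse) ?_ hT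
    rw [hTu]
    exact contDiffAt_map_inverse _
  have hev : ∀ᶠ z in nhds u, R' ∘L L z ∈ Set.range ((↑) : (E ≃L[ℝ] E) → E →L[ℝ] E) := by
    refine hT.continuousAt.eventually ?_
    change ∀ᶠ y in nhds (R' ∘L L u), _
    rw [hTu]
    exact ContinuousLinearEquiv.nhds _
  refine (hinv.clm_apply (R'.contDiff.contDiffAt.comp u hb)).congr_of_eventuallyEq ?_
  filter_upwards [h, hev] with z hz ⟨e, he⟩
  have hRb : R' (b z) = e (ξ z) := by
    rw [← hz]
    exact (DFunLike.congr_fun he (ξ z)).symm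
  change ξ z = (R' ∘L L z).inverse (R' (b z))
  rw [hRb, ← he, ContinuousLinearMap.inverse_equiv]
  exact (e.symm_apply_apply _).symm

section Koszul

variable {m : ℕ} {E : Type*} [NormedAddCommGroup E] [NormedSpace ℝ E] {f : E → Coord m}
  {ξ η ζ : E → E} {u : E}

lemma fderiv_lieBracket (hf : ContDiffAt ℝ 2 f u) (hξ : DifferentiableAt ℝ ξ u)
    (hη : DifferentiableAt ℝ η u) :
    fderiv ℝ f u (VectorField.lieBracket ℝ ξ η u) =
      covDeriv f (fun z => fderiv ℝ f z (η z)) u (ξ u)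
        - covDeriv f (fun z => fderiv ℝ f z (ξ z)) u (η u) := by
  have hd : DifferentiableAt ℝ (fderiv ℝ f) u :=
    (hf.fderiv_right (m := 1) (by norm_num)).differentiableAt one_ne_zero
  rw [covDeriv, covDeriv, fderiv_clm_apply hd hη, fderiv_clm_apply hd hξ, VectorField.lieBracket,
    christoffelForm_comm _ (fderiv ℝ f u (ξ u)), map_sub]
  have hsymm := (hf.isSymmSndFDerivAt (by simp)).eq (ξ u) (η u)
  simp only [add_apply, ContinuousLinearMap.comp_apply, ContinuousLinearMap.flip_apply, hsymm]
  abel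

lemma koszul_covDeriv (hf : ContDiffAt ℝ 2 f u) (h : Regular (f u))
    (hξ : DifferentiableAt ℝ ξ u) (hη : DifferentiableAt ℝ η u) (hζ : DifferentiableAt ℝ ζ u) :
    fderiv ℝ (fun z => metric (f z) (fderiv ℝ f z (η z)) (fderiv ℝ f z (ζ z))) u (ξ u)
        + fderiv ℝ (fun z => metric (f z) (fderiv ℝ f z (ξ z)) (fderiv ℝ f z (ζ z))) u (η u)
        - fderiv ℝ (fun z => metric (f z) (fderiv ℝ f z (ξ z)) (fderiv ℝ f z (η z))) u (ζ u)
        + metric (f u) (fderiv ℝ f u (VectorField.lieBracket ℝ ξ η u)) (fderiv ℝ f u (ζ u))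
        - metric (f u) (fderiv ℝ f u (VectorField.lieBracket ℝ ξ ζ u)) (fderiv ℝ f u (η u))
        - metric (f u) (fderiv ℝ f u (VectorField.lieBracket ℝ η ζ u)) (fderiv ℝ f u (ξ u)) =
      2 * metric (f u) (covDeriv f (fun z => fderiv ℝ f z (η z)) u (ξ u))
        (fderiv ℝ f u (ζ u)) := by
  have hf' := hf.differentiableAt two_ne_zero
  have hfield : ∀ {ξ : E → E}, DifferentiableAt ℝ ξ u →
      DifferentiableAt ℝ (fun z => fderiv ℝ f z (ξ z)) u :=
    ((hf.fderiv_right (m := 1) (by norm_num)).differentiableAt one_ne_zero).clm_apply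
  rw [fderiv_metric hf' h (hfield hη) (hfield hζ), fderiv_metric hf' h (hfield hξ) (hfield hζ),
    fderiv_metric hf' h (hfield hξ) (hfield hη), fderiv_lieBracket hf hξ hη,
    fderiv_lieBracket hf hξ hζ, fderiv_lieBracket hf hη hζ, metric_sub_left, metric_sub_left,
    metric_sub_left, metric_comm _ (fderiv ℝ f u (η u)), metric_comm _ (fderiv ℝ f u (ξ u)),
    metric_comm _ (fderiv ℝ f u (ξ u))]
  ring

end Koszul

/-! ### Oriented hypersurfaces -/

lemma exists_tangent_add_normal {m : ℕ} {E : Type*} [AddCommGroup E] [Module ℝ E]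
    [FiniteDimensional ℝ E] (hE : Module.finrank ℝ E + 1 = 4 * m) {p : Space m}
    {L : E →ₗ[ℝ] Coord m} (hL : Function.Injective L) {N : Coord m}
    (hN : metric (coord p) N N = 1) (hLN : ∀ X, metric (coord p) (L X) N = 0) (v : Coord m) :
    ∃ X, v = L X + metric (coord p) v N • N := by
  let T : E × ℝ →ₗ[ℝ] Coord m := L.coprod (LinearMap.toSpanSingleton ℝ (Coord m) N)
  have hT : ∀ X s, T (X, s) = L X + s • N := fun X s => by simp [T]
  have hnormal : ∀ X s, metric (coord p) (T (X, s)) N = s := fun X s => by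
    rw [hT, metric_add_left, hLN, metric_smul_left, hN]
    ring
  have hinj : Function.Injective T := by
    rw [← LinearMap.ker_eq_bot, LinearMap.ker_eq_bot']
    rintro ⟨X, s⟩ hXs
    have hs := hnormal X s
    rw [hXs, metric_zero_left] at hs
    rw [hT, ← hs, zero_smul, add_zero] at hXs
    rw [← hs, hL (hXs.trans (map_zero L).symm)]
    rfl
  have hdim : Module.finrank ℝ (E × ℝ) = Module.finrank ℝ (Coord m) := by
    rw [Module.finrank_prod, Module.finrank_self, hE, Module.finrank_pi_fintype]
    simp only [Module.finrank_pi_fintype, Complex.finrank_real_complex, Finset.sum_const,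
      Finset.card_univ, Fintype.card_fin, smul_eq_mul]
    ring
  obtain ⟨⟨X, s⟩, hXs⟩ :=
    (LinearMap.injective_iff_surjective_of_finrank_eq_finrank hdim).1 hinj v
  have hs := hnormal X s
  rw [hXs] at hs
  exact ⟨X, by rw [hs, ← hT, hXs]⟩

namespace OrientedHypersurface

variable {m : ℕ} {M : Type*} [TopologicalSpace M]
  [ChartedSpace (EuclideanSpace ℝ (Fin (4 * m - 1))) M] (S : OrientedHypersurface m M)

section Pointwise

variable (x : M) (X Y : TangentSpace (𝓡 (4 * m - 1)) x)

include S x in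
lemma dim_pos : 0 < m := by
  by_contra! hm
  obtain rfl : m = 0 := Nat.le_zero.1 hm
  have hunit := S.normal_unit x
  rw [Subsingleton.elim (S.normal x) 0, metric_zero_left] at hunit
  exact zero_ne_one hunit

lemma diff_injective : Function.Injective (S.diff x) := S.immersion x

lemma ambient_normal_self : S.ambient x (S.normal x) (S.normal x) = 1 := S.normal_unit x

lemma ambient_diff_normal : S.ambient x (S.diff x X) (S.normal x) = 0 := S.normal_orthogonal x X

lemma diff_tangential (v : Coord m) :
    S.diff x (S.tangential x v) = v - S.ambient x v (S.normal x) • S.normal x := by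
  have hdim : 4 * m - 1 + 1 = 4 * m := by have := S.dim_pos x; omega
  let L : EuclideanSpace ℝ (Fin (4 * m - 1)) →ₗ[ℝ] Coord m := (S.diff x).toLinearMap
  exact eq_sub_of_add_eq (Classical.epsilon_spec
    (p := fun X => v = S.diff x X + S.ambient x v (S.normal x) • S.normal x)
    (exists_tangent_add_normal (by rwa [finrank_euclideanSpace_fin]) (L := L)
      (S.diff_injective x) (S.ambient_normal_self x) (S.ambient_diff_normal x) v)).symm

lemma diff_reeb : S.diff x (S.reeb x) = -kaehler (S.normal x) := by
  rw [reeb, S.diff_tangential, ambient, metric_neg_left, metric_kaehler_self, neg_zero, zero_smul,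
    sub_zero]

lemma diff_phi (T : Coord m →ₗ[ℝ] Coord m) :
    S.diff x (S.phi x T X) = T (S.diff x X) - S.eta x T X • S.normal x :=
  S.diff_tangential x _

lemma g_add_left (X' : TangentSpace (𝓡 (4 * m - 1)) x) :
    S.g x (X + X') Y = S.g x X Y + S.g x X' Y := by
  rw [g, map_add, ambient, metric_add_left]
  rfl

lemma g_phi (T : Coord m →ₗ[ℝ] Coord m) :
    S.g x (S.phi x T X) Y = S.ambient x (T (S.diff x X)) (S.diff x Y) := by
  have hnormal := S.ambient_diff_normal x Y
  rw [ambient, metric_comm] at hnormal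
  rw [g, S.diff_phi, ambient, metric_sub_left, metric_smul_left, hnormal, mul_zero, sub_zero]
  rfl

lemma η_reeb : S.η x (S.reeb x) = 1 := by
  rw [η, eta, S.diff_reeb, map_neg, kaehler_kaehler, neg_neg, ambient_normal_self]

end Pointwise

section Chart

variable (x : M)

/-- The immersion read in the chart at `x`. -/
def chartFun (u : EuclideanSpace ℝ (Fin (4 * m - 1))) : Coord m :=
  coord (S.toFun ((extChartAt (𝓡 (4 * m - 1)) x).symm u))

/-- The normal field read in the chart at `x`. -/
def chartNormal (u : EuclideanSpace ℝ (Fin (4 * m - 1))) : Coord m :=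
  S.normal ((extChartAt (𝓡 (4 * m - 1)) x).symm u)

variable {x} {u : EuclideanSpace ℝ (Fin (4 * m - 1))}

lemma regular_chartFun (u : EuclideanSpace ℝ (Fin (4 * m - 1))) : Regular (S.chartFun x u) :=
  regular_coord _

lemma mdifferentiableAt_coord (y : M) :
    MDifferentiableAt (𝓡 (4 * m - 1)) 𝓘(ℝ, Coord m) (fun z => coord (S.toFun z)) y :=
  S.smooth.contMDiffAt.mdifferentiableAt (by simp)

lemma mdifferentiableAt_normal (y : M) :
    MDifferentiableAt (𝓡 (4 * m - 1)) 𝓘(ℝ, Coord m) S.normal y :=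
  S.smooth_normal.contMDiffAt.mdifferentiableAt (by simp)

lemma chartFun_self : S.chartFun x (extChartAt (𝓡 (4 * m - 1)) x x) = coord (S.toFun x) := by
  rw [chartFun, extChartAt_to_inv]

lemma chartNormal_self : S.chartNormal x (extChartAt (𝓡 (4 * m - 1)) x x) = S.normal x := by
  rw [chartNormal, extChartAt_to_inv]

lemma diff_eq_fderiv (X : TangentSpace (𝓡 (4 * m - 1)) x) :
    S.diff x X = fderiv ℝ (S.chartFun x) (extChartAt (𝓡 (4 * m - 1)) x x) X :=
  mvfderiv_eq_fderiv_comp_chart (S.mdifferentiableAt_coord x) X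

lemma ambientCov_eq_covDeriv {V : M → Coord m}
    (hV : MDifferentiableAt (𝓡 (4 * m - 1)) 𝓘(ℝ, Coord m) V x)
    (X : TangentSpace (𝓡 (4 * m - 1)) x) :
    S.ambientCov V x X = covDeriv (S.chartFun x)
      (fun z => V ((extChartAt (𝓡 (4 * m - 1)) x).symm z)) (extChartAt (𝓡 (4 * m - 1)) x x) X := by
  have hVx := congrArg V (extChartAt_to_inv (I := 𝓡 (4 * m - 1)) x)
  rw [ambientCov, christoffel_eq_christoffelForm, S.diff_eq_fderiv,
    mvfderiv_eq_fderiv_comp_chart hV, ← S.chartFun_self, ← hVx]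
  rfl

lemma ambientCov_normal_eq_covDeriv (X : TangentSpace (𝓡 (4 * m - 1)) x) :
    S.ambientCov S.normal x X =
      covDeriv (S.chartFun x) (S.chartNormal x) (extChartAt (𝓡 (4 * m - 1)) x x) X :=
  S.ambientCov_eq_covDeriv (S.mdifferentiableAt_normal x) X

variable [IsManifold (𝓡 (4 * m - 1)) ∞ M]

variable (x) in
lemma contDiffAt_chartFun :
    ContDiffAt ℝ ∞ (S.chartFun x) (extChartAt (𝓡 (4 * m - 1)) x x) :=
  contDiffAt_comp_chart le_rfl S.smooth.contMDiffAt

variable (x) in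
lemma contDiffAt_chartNormal :
    ContDiffAt ℝ ∞ (S.chartNormal x) (extChartAt (𝓡 (4 * m - 1)) x x) :=
  contDiffAt_comp_chart le_rfl S.smooth_normal.contMDiffAt

lemma diff_chartDeriv (hu : u ∈ (extChartAt (𝓡 (4 * m - 1)) x).target)
    (v : EuclideanSpace ℝ (Fin (4 * m - 1))) :
    S.diff ((extChartAt (𝓡 (4 * m - 1)) x).symm u) (chartDeriv x u v) =
      fderiv ℝ (S.chartFun x) u v :=
  (fderiv_comp_chart hu (S.mdifferentiableAt_coord _) v).symm

lemma ambientCov_chartDeriv (hu : u ∈ (extChartAt (𝓡 (4 * m - 1)) x).target)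
    (v : EuclideanSpace ℝ (Fin (4 * m - 1))) :
    S.ambientCov S.normal ((extChartAt (𝓡 (4 * m - 1)) x).symm u) (chartDeriv x u v) =
      covDeriv (S.chartFun x) (S.chartNormal x) u v := by
  rw [ambientCov, covDeriv, christoffel_eq_christoffelForm, S.diff_chartDeriv hu]
  congr 1
  exact (fderiv_comp_chart hu (S.mdifferentiableAt_normal _) v).symm

end Chart

section SecondFundamentalForm

variable [IsManifold (𝓡 (4 * m - 1)) ∞ M] (x : M)

lemma ambient_ambientCov_normal (X : TangentSpace (𝓡 (4 * m - 1)) x) :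
    S.ambient x (S.ambientCov S.normal x X) (S.normal x) = 0 := by
  have hN := (S.contDiffAt_chartNormal x).differentiableAt (by simp)
  have hnorm := fderiv_metric ((S.contDiffAt_chartFun x).differentiableAt (by simp))
    (S.regular_chartFun _) hN hN X
  have hunit : (fun u => metric (S.chartFun x u) (S.chartNormal x u) (S.chartNormal x u)) =
      fun _ => 1 := funext fun u => S.normal_unit _
  rw [hunit, fderiv_fun_const, metric_comm _ (S.chartNormal x _),
    ← S.ambientCov_normal_eq_covDeriv, S.chartFun_self, S.chartNormal_self] at hnorm
  change (0 : ℝ) = S.ambient x _ _ + S.ambient x _ _ at hnorm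
  linarith

lemma diff_shape (X : TangentSpace (𝓡 (4 * m - 1)) x) :
    S.diff x (S.shape x X) = -S.ambientCov S.normal x X := by
  rw [shape, S.diff_tangential, ambient, metric_neg_left, ← ambient, S.ambient_ambientCov_normal,
    neg_zero, zero_smul, sub_zero]

lemma ambient_covDeriv_fderiv (v w : EuclideanSpace ℝ (Fin (4 * m - 1))) :
    S.ambient x (covDeriv (S.chartFun x) (fun z => fderiv ℝ (S.chartFun x) z w)
        (extChartAt (𝓡 (4 * m - 1)) x x) v) (S.normal x) =
      -S.ambient x (S.diff x w) (S.ambientCov S.normal x v) := by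
  have hf := S.contDiffAt_chartFun x
  have hderiv := fderiv_metric (hf.differentiableAt (by simp)) (S.regular_chartFun _)
    (((hf.fderiv_right (m := ∞) (by simp)).clm_apply
      (contDiffAt_const (c := w))).differentiableAt (by simp))
    ((S.contDiffAt_chartNormal x).differentiableAt (by simp)) v
  have horthogonal : (fun z => metric (S.chartFun x z) (fderiv ℝ (S.chartFun x) z w)
      (S.chartNormal x z)) =ᶠ[nhds (extChartAt (𝓡 (4 * m - 1)) x x)] fun _ => 0 := by
    filter_upwards [extChartAt_target_mem_nhds (I := 𝓡 (4 * m - 1)) x] with z hz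
    rw [← S.diff_chartDeriv hz]
    exact S.ambient_diff_normal _ _
  rw [horthogonal.fderiv_eq, fderiv_fun_const, Pi.zero_apply, zero_apply, S.chartFun_self,
    S.chartNormal_self] at hderiv
  exact (eq_neg_of_add_eq_zero_left hderiv.symm).trans (congrArg Neg.neg (congrArg₂ (S.ambient x)
    (S.diff_eq_fderiv w).symm (S.ambientCov_normal_eq_covDeriv v).symm))

lemma ambient_diff_ambientCov_comm (X Y : TangentSpace (𝓡 (4 * m - 1)) x) :
    S.ambient x (S.diff x X) (S.ambientCov S.normal x Y) =
      S.ambient x (S.diff x Y) (S.ambientCov S.normal x X) := by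
  have hcomm := covDeriv_fderiv_comm
    ((S.contDiffAt_chartFun x).of_le (WithTop.coe_le_coe.2 le_top)) Y X
  exact neg_injective ((S.ambient_covDeriv_fderiv x Y X).symm.trans
    ((congrArg (S.ambient x · (S.normal x)) hcomm).trans (S.ambient_covDeriv_fderiv x X Y)))

lemma g_shape_comm (X Y : TangentSpace (𝓡 (4 * m - 1)) x) :
    S.g x (S.shape x X) Y = S.g x X (S.shape x Y) := by
  rw [g, g, S.diff_shape, S.diff_shape, ambient, ambient, metric_neg_left, metric_neg_right,
    metric_comm]
  exact congrArg Neg.neg (S.ambient_diff_ambientCov_comm x Y X)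

end SecondFundamentalForm

section Koszul

variable [IsManifold (𝓡 (4 * m - 1)) ∞ M] {x : M} {V W Z : Π y : M, TangentSpace (𝓡 (4 * m - 1)) y}

lemma diff_chartField {z : EuclideanSpace ℝ (Fin (4 * m - 1))}
    (hz : z ∈ (extChartAt (𝓡 (4 * m - 1)) x).target) (V : Π y : M, TangentSpace (𝓡 (4 * m - 1)) y) :
    S.diff ((extChartAt (𝓡 (4 * m - 1)) x).symm z) (V ((extChartAt (𝓡 (4 * m - 1)) x).symm z)) =
      fderiv ℝ (S.chartFun x) z (chartField x V z) := by
  rw [← S.diff_chartDeriv hz, chartDeriv_chartField V hz]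

lemma diff_chartField_self (V : Π y : M, TangentSpace (𝓡 (4 * m - 1)) y) :
    S.diff x (V x) = fderiv ℝ (S.chartFun x) (extChartAt (𝓡 (4 * m - 1)) x x)
      (chartField x V (extChartAt (𝓡 (4 * m - 1)) x x)) := by
  rw [chartField_self]
  exact S.diff_eq_fderiv (V x)

lemma contDiffAt_fderiv_chartField
    (hV : ContDiffAt ℝ 1 (chartField x V) (extChartAt (𝓡 (4 * m - 1)) x x)) :
    ContDiffAt ℝ 1 (fun z => fderiv ℝ (S.chartFun x) z (chartField x V z))
      (extChartAt (𝓡 (4 * m - 1)) x x) :=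
  (((S.contDiffAt_chartFun x).of_le (m := 2) (WithTop.coe_le_coe.2 le_top)).fderiv_right
    (m := 1) (by norm_num)).clm_apply hV

lemma mvfderiv_g (hV : ContDiffAt ℝ 1 (chartField x V) (extChartAt (𝓡 (4 * m - 1)) x x))
    (hW : ContDiffAt ℝ 1 (chartField x W) (extChartAt (𝓡 (4 * m - 1)) x x))
    (Z : Π y : M, TangentSpace (𝓡 (4 * m - 1)) y) :
    mvfderiv (𝓡 (4 * m - 1)) (fun y => S.g y (V y) (W y)) x (Z x) =
      fderiv ℝ (fun z => metric (S.chartFun x z) (fderiv ℝ (S.chartFun x) z (chartField x V z))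
          (fderiv ℝ (S.chartFun x) z (chartField x W z))) (extChartAt (𝓡 (4 * m - 1)) x x)
        (chartField x Z (extChartAt (𝓡 (4 * m - 1)) x x)) := by
  have hchart : (fun z => S.g ((extChartAt (𝓡 (4 * m - 1)) x).symm z) (V _) (W _)) =ᶠ[nhds
      (extChartAt (𝓡 (4 * m - 1)) x x)] fun z => metric (S.chartFun x z)
        (fderiv ℝ (S.chartFun x) z (chartField x V z))
        (fderiv ℝ (S.chartFun x) z (chartField x W z)) := by
    filter_upwards [extChartAt_target_mem_nhds (I := 𝓡 (4 * m - 1)) x] with z hz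
    rw [g, S.diff_chartField hz, S.diff_chartField hz]
    rfl
  have hsmooth := (contDiffAt_metric ((S.contDiffAt_chartFun x).of_le (by simp))
    (S.regular_chartFun _) (S.contDiffAt_fderiv_chartField hV)
    (S.contDiffAt_fderiv_chartField hW)).congr_of_eventuallyEq hchart
  rw [← hchart.fderiv_eq, chartField_self]
  exact mvfderiv_eq_fderiv_comp_chart
    ((contMDiffAt_of_comp_chart hsmooth).mdifferentiableAt one_ne_zero) (Z x)

lemma ambientCov_diff (hW : ContDiffAt ℝ 1 (chartField x W) (extChartAt (𝓡 (4 * m - 1)) x x))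
    (V : Π y : M, TangentSpace (𝓡 (4 * m - 1)) y) :
    S.ambientCov (fun y => S.diff y (W y)) x (V x) =
      covDeriv (S.chartFun x) (fun z => fderiv ℝ (S.chartFun x) z (chartField x W z))
        (extChartAt (𝓡 (4 * m - 1)) x x) (chartField x V (extChartAt (𝓡 (4 * m - 1)) x x)) := by
  have hchart : (fun z => S.diff ((extChartAt (𝓡 (4 * m - 1)) x).symm z) (W _)) =ᶠ[nhds
      (extChartAt (𝓡 (4 * m - 1)) x x)]
        fun z => fderiv ℝ (S.chartFun x) z (chartField x W z) := by
    filter_upwards [extChartAt_target_mem_nhds (I := 𝓡 (4 * m - 1)) x] with z hz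
    exact S.diff_chartField hz W
  have hsmooth := (S.contDiffAt_fderiv_chartField hW).congr_of_eventuallyEq hchart
  rw [covDeriv, ← hchart.fderiv_eq, ← hchart.eq_of_nhds, chartField_self]
  exact S.ambientCov_eq_covDeriv
    ((contMDiffAt_of_comp_chart hsmooth).mdifferentiableAt one_ne_zero) (V x)

lemma diff_mlieBracket (V W : Π y : M, TangentSpace (𝓡 (4 * m - 1)) y) :
    S.diff x (VectorField.mlieBracket (𝓡 (4 * m - 1)) V W x) =
      fderiv ℝ (S.chartFun x) (extChartAt (𝓡 (4 * m - 1)) x x) (VectorField.lieBracket ℝ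
        (chartField x V) (chartField x W) (extChartAt (𝓡 (4 * m - 1)) x x)) :=
  (S.diff_eq_fderiv _).trans (congrArg _ (mlieBracket_eq_lieBracket_chartField V W))

lemma gauss_formula (hV : ContDiffAt ℝ 1 (chartField x V) (extChartAt (𝓡 (4 * m - 1)) x x))
    (hW : ContDiffAt ℝ 1 (chartField x W) (extChartAt (𝓡 (4 * m - 1)) x x))
    (hZ : ContDiffAt ℝ 1 (chartField x Z) (extChartAt (𝓡 (4 * m - 1)) x x)) :
    S.koszul V W Z x =
      2 * S.ambient x (S.ambientCov (fun y => S.diff y (W y)) x (V x)) (S.diff x (Z x)) := by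
  rw [S.ambientCov_diff hW, koszul, S.mvfderiv_g hW hZ, S.mvfderiv_g hV hZ, S.mvfderiv_g hV hW,
    g, g, g, S.diff_mlieBracket, S.diff_mlieBracket, S.diff_mlieBracket, S.diff_chartField_self,
    S.diff_chartField_self, S.diff_chartField_self, ambient, ambient, ambient, ambient,
    ← S.chartFun_self]
  exact koszul_covDeriv ((S.contDiffAt_chartFun x).of_le (WithTop.coe_le_coe.2 le_top))
    (S.regular_chartFun _) (hV.differentiableAt one_ne_zero) (hW.differentiableAt one_ne_zero)
    (hZ.differentiableAt one_ne_zero)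

end Koszul

section Reeb

variable [IsManifold (𝓡 (4 * m - 1)) ∞ M] (x : M)

lemma contDiffAt_chartField_reeb :
    ContDiffAt ℝ ∞ (chartField x S.reeb) (extChartAt (𝓡 (4 * m - 1)) x x) := by
  have hinj : Function.Injective
      (fderiv ℝ (S.chartFun x) (extChartAt (𝓡 (4 * m - 1)) x x)) := fun v w hvw =>
    S.diff_injective x ((S.diff_eq_fderiv v).trans (hvw.trans (S.diff_eq_fderiv w).symm))
  refine contDiffAt_of_clm_apply_eq ((S.contDiffAt_chartFun x).fderiv_right (by simp))
    ((S.contDiffAt_chartNormal x).const_smul Complex.I).neg hinj ?_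
  filter_upwards [extChartAt_target_mem_nhds (I := 𝓡 (4 * m - 1)) x] with z hz
  rw [← S.diff_chartField hz, S.diff_reeb]
  rfl

lemma ambientCov_diff_reeb (X : TangentSpace (𝓡 (4 * m - 1)) x) :
    S.ambientCov (fun y => S.diff y (S.reeb y)) x X = -kaehler (S.ambientCov S.normal x X) := by
  have hreeb : (fun y => S.diff y (S.reeb y)) = fun y => -Complex.I • S.normal y :=
    funext fun y => (S.diff_reeb y).trans (neg_smul _ _).symm
  have hN := S.contDiffAt_chartNormal x
  have hsmooth := contMDiffAt_of_comp_chart (h := fun y => -Complex.I • S.normal y)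
    (hN.const_smul (-Complex.I))
  rw [hreeb, S.ambientCov_eq_covDeriv (hsmooth.mdifferentiableAt (by simp)),
    S.ambientCov_normal_eq_covDeriv, kaehler_apply, ← neg_smul]
  exact covDeriv_const_smul _ (hN.differentiableAt (by simp)) _

lemma ambient_kaehler_ambientCov_reeb (hS : S.GeodesicReebFlow)
    (X : TangentSpace (𝓡 (4 * m - 1)) x) :
    S.ambient x (kaehler (S.ambientCov S.normal x (S.reeb x))) (S.diff x X) = 0 := by
  let Z : Π y : M, TangentSpace (𝓡 (4 * m - 1)) y :=
    FiberBundle.extend (EuclideanSpace ℝ (Fin (4 * m - 1))) X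
  have hZx : Z x = X := FiberBundle.extend_apply_self _ X
  have hZ : ContMDiffAt (𝓡 (4 * m - 1)) (𝓡 (4 * m - 1)).tangent ∞
      (fun y => (⟨y, Z y⟩ : TangentBundle (𝓡 (4 * m - 1)) M)) x :=
    FiberBundle.contMDiffAt_extend (𝓡 (4 * m - 1)) (EuclideanSpace ℝ (Fin (4 * m - 1))) X
  have hreeb := (S.contDiffAt_chartField_reeb x).of_le (m := 1) (by simp)
  have hkoszul := hS x Z hZ
  rw [S.gauss_formula hreeb hreeb (contDiffAt_chartField (hZ.of_le (by simp))), hZx,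
    S.ambientCov_diff_reeb, g, map_zero, ambient, ambient, metric_zero_left, metric_neg_left]
    at hkoszul
  rw [ambient]
  linarith

/-- The principal curvature `α = g(A ξ, ξ)` of the Reeb vector field. -/
def hopfCurvature (x : M) : ℝ := S.g x (S.shape x (S.reeb x)) (S.reeb x)

lemma hopfCurvature_eq : S.hopfCurvature x =
    S.ambient x (S.ambientCov S.normal x (S.reeb x)) (kaehler (S.normal x)) := by
  rw [hopfCurvature, g, S.diff_shape, S.diff_reeb, ambient, metric_neg_left, metric_neg_right,
    neg_neg, ambient]

lemma contMDiff_hopfCurvature : ContMDiff (𝓡 (4 * m - 1)) 𝓘(ℝ, ℝ) ∞ S.hopfCurvature := by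
  intro x
  have hf := S.contDiffAt_chartFun x
  have hN := S.contDiffAt_chartNormal x
  refine contMDiffAt_of_comp_chart ((contDiffAt_metric hf (S.regular_chartFun _)
    (contDiffAt_covDeriv (by simp) hf (S.regular_chartFun _) hN (S.contDiffAt_chartField_reeb x))
    (hN.const_smul Complex.I)).congr_of_eventuallyEq ?_)
  filter_upwards [extChartAt_target_mem_nhds (I := 𝓡 (4 * m - 1)) x] with z hz
  rw [hopfCurvature_eq, ← S.ambientCov_chartDeriv hz, chartDeriv_chartField _ hz]
  rfl

lemma ambientCov_reeb (hS : S.GeodesicReebFlow) :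
    S.ambientCov S.normal x (S.reeb x) = S.hopfCurvature x • kaehler (S.normal x) := by
  set D := S.ambientCov S.normal x (S.reeb x)
  have htangential : S.diff x (S.tangential x (kaehler D)) = 0 := by
    by_contra hne
    refine (metric_self_pos (S.toFun x) hne).ne' ?_
    nth_rw 1 [S.diff_tangential]
    have hdiff := S.ambient_diff_normal x (S.tangential x (kaehler D))
    rw [ambient, metric_comm] at hdiff
    rw [metric_sub_left, metric_smul_left, hdiff, mul_zero, sub_zero]
    exact S.ambient_kaehler_ambientCov_reeb x hS _
  rw [S.diff_tangential, sub_eq_zero, ambient, metric_kaehler_left, ← ambient, ← hopfCurvature_eq]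
    at htangential
  rw [← neg_inj, ← kaehler_kaehler, htangential, map_smul, neg_smul]

lemma shape_reeb (hS : S.GeodesicReebFlow) :
    S.shape x (S.reeb x) = S.hopfCurvature x • S.reeb x := by
  apply S.diff_injective x
  rw [S.diff_shape, map_smul, S.ambientCov_reeb x hS, S.diff_reeb, smul_neg]

lemma ambient_ambientCov_kaehler (hS : S.GeodesicReebFlow) (X : TangentSpace (𝓡 (4 * m - 1)) x) :
    S.ambient x (S.ambientCov S.normal x X) (kaehler (S.normal x)) =
      S.hopfCurvature x * -S.ambient x (S.diff x X) (kaehler (S.normal x)) := by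
  have hcomm := S.ambient_diff_ambientCov_comm x (S.reeb x) X
  rw [S.diff_reeb, S.ambientCov_reeb x hS, ambient, ambient, metric_neg_left, metric_smul_right,
    metric_comm] at hcomm
  rw [ambient, ambient]
  linarith

end Reeb

section Codazzi

variable (x : M) (X Y : TangentSpace (𝓡 (4 * m - 1)) x)

/-- The two-form `(X, Y) ↦ g((∇_X A) Y - (∇_Y A) X, ξ)`, expressed through the ambient curvature by
the Codazzi equation. -/
def codazziForm : ℝ :=
  normalCurvature (coord (S.toFun x)) (S.normal x) (S.diff x X) (S.diff x Y)

lemma ambient_diff_kaehler_normal :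
    S.ambient x (S.diff x X) (kaehler (S.normal x)) = -S.η x X := by
  rw [η, eta, ambient, ambient, metric_kaehler_left, neg_neg]

variable [IsManifold (𝓡 (4 * m - 1)) ∞ M]

lemma g_φ_shape : S.g x (S.φ x (S.shape x X)) Y =
    -S.ambient x (S.diff x Y) (kaehler (S.ambientCov S.normal x X)) := by
  rw [φ, S.g_phi, S.diff_shape, map_neg, ambient, ambient, metric_neg_left, metric_comm]

lemma g_shape_φ : S.g x (S.shape x (S.φ x X)) Y =
    S.ambient x (S.diff x X) (kaehler (S.ambientCov S.normal x Y)) := by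
  rw [g_shape_comm, φ, S.g_phi, S.diff_shape, ambient, ambient, metric_kaehler_left, map_neg,
    metric_neg_right, neg_neg]

lemma g_shape_φ_shape : S.g x (S.shape x (S.φ x (S.shape x X))) Y =
    S.ambient x (S.ambientCov S.normal x Y) (kaehler (S.ambientCov S.normal x X)) := by
  rw [g_shape_comm, g_φ_shape, S.diff_shape, ambient, ambient, metric_neg_left, neg_neg]

lemma codazziForm_add (hS : S.GeodesicReebFlow) :
    S.codazziForm x X Y + 2 * S.g x (S.shape x (S.φ x (S.shape x X))) Y =
      mvfderiv (𝓡 (4 * m - 1)) S.hopfCurvature x X * S.η x Y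
        - mvfderiv (𝓡 (4 * m - 1)) S.hopfCurvature x Y * S.η x X
        + S.hopfCurvature x * S.g x (S.shape x (S.φ x X) + S.φ x (S.shape x X)) Y := by
  have hα := S.contMDiff_hopfCurvature.contMDiffAt (x := x)
  have hω : ∀ᶠ z in nhds (extChartAt (𝓡 (4 * m - 1)) x x), ∀ w,
      metric (S.chartFun x z) (covDeriv (S.chartFun x) (S.chartNormal x) z w)
        (kaehler (S.chartNormal x z)) =
      S.hopfCurvature ((extChartAt (𝓡 (4 * m - 1)) x).symm z) *
        -metric (S.chartFun x z) (fderiv ℝ (S.chartFun x) z w) (kaehler (S.chartNormal x z)) := by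
    filter_upwards [extChartAt_target_mem_nhds (I := 𝓡 (4 * m - 1)) x] with z hz w
    rw [← S.ambientCov_chartDeriv hz, ← S.diff_chartDeriv hz]
    exact S.ambient_ambientCov_kaehler _ hS _
  have hcurvature := metric_curvature_kaehler
    ((S.contDiffAt_chartFun x).of_le (WithTop.coe_le_coe.2 le_top)) (S.regular_chartFun _)
    ((S.contDiffAt_chartNormal x).of_le (WithTop.coe_le_coe.2 le_top))
    ((contDiffAt_comp_chart le_rfl hα).differentiableAt (by simp)) hω X Y
  rw [← mvfderiv_eq_fderiv_comp_chart (hα.mdifferentiableAt (by simp)) X,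
    ← mvfderiv_eq_fderiv_comp_chart (hα.mdifferentiableAt (by simp)) Y,
    ← S.diff_eq_fderiv X, ← S.diff_eq_fderiv Y, ← S.ambientCov_normal_eq_covDeriv X,
    ← S.ambientCov_normal_eq_covDeriv Y, S.chartFun_self, S.chartNormal_self, extChartAt_to_inv]
    at hcurvature
  rw [g_shape_φ_shape, g_add_left, g_φ_shape, g_shape_φ, ← sub_eq_add_neg,
    ← neg_neg (S.η x X), ← neg_neg (S.η x Y), ← ambient_diff_kaehler_normal,
    ← ambient_diff_kaehler_normal]
  exact hcurvature

lemma codazziForm_reeb (hS : S.GeodesicReebFlow) : S.codazziForm x (S.reeb x) Y =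
    mvfderiv (𝓡 (4 * m - 1)) S.hopfCurvature x (S.reeb x) * S.η x Y
      - mvfderiv (𝓡 (4 * m - 1)) S.hopfCurvature x Y := by
  have hshape : S.g x (S.shape x (S.φ x (S.shape x (S.reeb x)))) Y = 0 := by
    rw [g_shape_φ_shape, S.ambientCov_reeb x hS, map_smul, kaehler_kaehler, ambient,
      metric_smul_right, metric_neg_right, ← ambient, ambient_ambientCov_normal, neg_zero, mul_zero]
  have hleft : S.g x (S.shape x (S.φ x (S.reeb x))) Y = 0 := by
    rw [g_shape_φ, S.diff_reeb, ambient, metric_neg_left, metric_kaehler_kaehler, metric_comm,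
      ← ambient, ambient_ambientCov_normal, neg_zero]
  have hright : S.g x (S.φ x (S.shape x (S.reeb x))) Y = 0 := by
    rw [g_φ_shape, S.ambientCov_reeb x hS, map_smul, kaehler_kaehler, ambient, metric_smul_right,
      metric_neg_right, ← ambient, ambient_diff_normal, neg_zero, mul_zero, neg_zero]
  have hadd := S.codazziForm_add x (S.reeb x) Y hS
  rw [hshape, g_add_left, hleft, hright, η_reeb] at hadd
  linarith

lemma two_mul_g_shape_φ_shape_sub (hS : S.GeodesicReebFlow) :
    2 * S.g x (S.shape x (S.φ x (S.shape x X))) Y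
        - S.hopfCurvature x * S.g x (S.shape x (S.φ x X) + S.φ x (S.shape x X)) Y =
      S.η x X * S.codazziForm x (S.reeb x) Y - S.η x Y * S.codazziForm x (S.reeb x) X
        - S.codazziForm x X Y := by
  rw [codazziForm_reeb _ _ _ hS, codazziForm_reeb _ _ _ hS]
  linear_combination S.codazziForm_add x X Y hS

end Codazzi

section CanonicalBasis

variable (x : M) (X Y : TangentSpace (𝓡 (4 * m - 1)) x) {T : Coord m →ₗ[ℝ] Coord m}

lemma eta_φ (hT : T ∈ quaternionic (S.toFun x)) : S.eta x T (S.φ x X) =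
    -(hermitianForm (coord (S.toFun x)) (T (S.diff x X)) (S.normal x)).im := by
  rw [eta, φ, S.diff_phi, map_sub, map_smul, quaternionic_kaehler hT, ambient, metric_sub_left,
    metric_smul_left, metric_quaternionic_self hT, mul_zero, sub_zero, metric_kaehler_eq_neg_im]

lemma eta_reeb (hT : T ∈ quaternionic (S.toFun x)) : S.eta x T (S.reeb x) =
    (hermitianForm (coord (S.toFun x)) (T (S.normal x)) (S.normal x)).im := by
  rw [eta, S.diff_reeb, map_neg, quaternionic_kaehler hT, ambient, metric_neg_left,
    metric_kaehler_eq_neg_im, neg_neg]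

lemma quartic_re_eq_codazziForm :
    2 * (quartic (coord (S.toFun x)) (S.diff x X) (S.normal x) (S.normal x) (S.normal x)).re =
      S.codazziForm x (S.reeb x) X / 2 := by
  rw [codazziForm, S.diff_reeb, normalCurvature_reeb]
  ring

variable {S x} {Jq : Fin 3 → Coord m →ₗ[ℝ] Coord m}
  (hJ : IsCanonicalBasis (S.toFun x) Jq)
include hJ

lemma sum_eta_mul_eta_φ_sub :
    ∑ ν, (S.eta x (Jq ν) X * S.eta x (Jq ν) (S.φ x Y)
        - S.eta x (Jq ν) Y * S.eta x (Jq ν) (S.φ x X)) =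
      2 * (quartic (coord (S.toFun x)) (S.diff x X) (S.normal x) (S.normal x) (S.diff x Y)).im := by
  have hre (Z : TangentSpace (𝓡 (4 * m - 1)) x) :
      (hermitianForm (coord (S.toFun x)) (S.diff x Z) (S.normal x)).re = 0 :=
    S.ambient_diff_normal x Z
  have hsum := hJ.sum_im_mul_re_sub (S.diff x X) (S.diff x Y) (S.normal x)
  rw [← star_hermitianForm _ (S.diff x Y), Complex.star_def, Complex.mul_im, Complex.conj_re,
    hre X, hre Y, zero_mul, mul_zero, add_zero, sub_zero] at hsum
  rw [← hsum]
  refine Finset.sum_congr rfl fun ν _ => ?_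
  rw [S.eta_φ _ _ (hJ.mem ν), S.eta_φ _ _ (hJ.mem ν), eta, eta, ambient, ambient, metric_eq_re,
    metric_eq_re]
  ring

lemma sum_g_phi_mul_eta_reeb :
    ∑ ν, S.g x (S.phi x (Jq ν) X) Y * S.eta x (Jq ν) (S.reeb x) =
      -S.g x (S.φ x X) Y
        - 2 * (quartic (coord (S.toFun x)) (S.diff x X) (S.diff x Y) (S.normal x) (S.normal x)).im
      := by
  rw [φ, S.g_phi, ambient, metric_kaehler_eq_neg_im, neg_neg,
    ← hJ.sum_re_mul_im _ _ (S.normal_unit x)]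
  refine Finset.sum_congr rfl fun ν _ => ?_
  rw [S.g_phi, S.eta_reeb _ (hJ.mem ν), ambient, metric_eq_re]

lemma sum_eta_φ_mul_eta_reeb :
    ∑ ν, S.eta x (Jq ν) (S.φ x X) * S.eta x (Jq ν) (S.reeb x) =
      -(S.codazziForm x (S.reeb x) X / 2) := by
  have hsum := hJ.sum_im_mul_im (S.diff x X) (S.normal_unit x)
  rw [← ambient, S.ambient_diff_normal, sub_zero, quartic_re_eq_codazziForm] at hsum
  rw [← hsum, ← Finset.sum_neg_distrib]
  refine Finset.sum_congr rfl fun ν _ => ?_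
  rw [S.eta_φ _ _ (hJ.mem ν), S.eta_reeb _ (hJ.mem ν), neg_mul]

lemma sum_canonicalBasis :
    ∑ ν, (S.eta x (Jq ν) X * S.eta x (Jq ν) (S.φ x Y)
        - S.eta x (Jq ν) Y * S.eta x (Jq ν) (S.φ x X)
        - S.g x (S.phi x (Jq ν) X) Y * S.eta x (Jq ν) (S.reeb x)
        - 2 * S.η x X * S.eta x (Jq ν) (S.φ x Y) * S.eta x (Jq ν) (S.reeb x)
        + 2 * S.η x Y * S.eta x (Jq ν) (S.φ x X) * S.eta x (Jq ν) (S.reeb x)) =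
      S.g x (S.φ x X) Y + S.η x X * S.codazziForm x (S.reeb x) Y
        - S.η x Y * S.codazziForm x (S.reeb x) X - S.codazziForm x X Y := by
  simp only [Finset.sum_add_distrib, Finset.sum_sub_distrib, mul_assoc, ← Finset.mul_sum,
    sum_g_phi_mul_eta_reeb X Y hJ, sum_eta_φ_mul_eta_reeb _ hJ]
  rw [← Finset.sum_sub_distrib, sum_eta_mul_eta_φ_sub X Y hJ]
  have hcodazzi : S.codazziForm x X Y = _ := normalCurvature_eq _ _ _ _
  linear_combination hcodazzi

end CanonicalBasis

end OrientedHypersurface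

end HyperbolicGrassmannian

end

theorem proposition2p1_general {m : ℕ} {M : Type*} [TopologicalSpace M]
    [ChartedSpace (EuclideanSpace ℝ (Fin (4 * m - 1))) M] [IsManifold (𝓡 (4 * m - 1)) ∞ M]
    (S : HyperbolicGrassmannian.OrientedHypersurface m M) (hS : S.GeodesicReebFlow) :
    ∃ α : M → ℝ, ContMDiff (𝓡 (4 * m - 1)) 𝓘(ℝ, ℝ) ∞ α ∧
      (∀ x, S.shape x (S.reeb x) = α x • S.reeb x) ∧
      ∀ (x : M) (Jq : Fin 3 → HyperbolicGrassmannian.Coord m →ₗ[ℝ] HyperbolicGrassmannian.Coord m),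
        HyperbolicGrassmannian.IsCanonicalBasis (S.toFun x) Jq →
        ∀ X Y : TangentSpace (𝓡 (4 * m - 1)) x,
          2 * S.g x (S.shape x (S.φ x (S.shape x X))) Y
              - α x * S.g x (S.shape x (S.φ x X) + S.φ x (S.shape x X)) Y + S.g x (S.φ x X) Y =
            ∑ ν : Fin 3,
              (S.eta x (Jq ν) X * S.eta x (Jq ν) (S.φ x Y)
                - S.eta x (Jq ν) Y * S.eta x (Jq ν) (S.φ x X)
                - S.g x (S.phi x (Jq ν) X) Y * S.eta x (Jq ν) (S.reeb x)
                - 2 * S.η x X * S.eta x (Jq ν) (S.φ x Y) * S.eta x (Jq ν) (S.reeb x)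
                + 2 * S.η x Y * S.eta x (Jq ν) (S.φ x X) * S.eta x (Jq ν) (S.reeb x)) := by
  refine ⟨S.hopfCurvature, S.contMDiff_hopfCurvature, fun x => S.shape_reeb x hS,
    fun x Jq hJ X Y => ?_⟩
  rw [HyperbolicGrassmannian.OrientedHypersurface.sum_canonicalBasis X Y hJ]
  linarith [S.two_mul_g_shape_φ_shape_sub x X Y hS]

theorem proposition2p1 (m : ℕ) (hm : 2 ≤ m) {M : Type*} [TopologicalSpace M] [ConnectedSpace M]
    [ChartedSpace (EuclideanSpace ℝ (Fin (4 * m - 1))) M] [IsManifold (𝓡 (4 * m - 1)) ∞ M]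
    (S : HyperbolicGrassmannian.OrientedHypersurface m M) (hS : S.GeodesicReebFlow) :
    ∃ α : M → ℝ, ContMDiff (𝓡 (4 * m - 1)) 𝓘(ℝ, ℝ) ∞ α ∧
      (∀ x, S.shape x (S.reeb x) = α x • S.reeb x) ∧
      ∀ (x : M) (Jq : Fin 3 → HyperbolicGrassmannian.Coord m →ₗ[ℝ] HyperbolicGrassmannian.Coord m),
        HyperbolicGrassmannian.IsCanonicalBasis (S.toFun x) Jq →
        ∀ X Y : TangentSpace (𝓡 (4 * m - 1)) x,
          2 * S.g x (S.shape x (S.φ x (S.shape x X))) Y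
              - α x * S.g x (S.shape x (S.φ x X) + S.φ x (S.shape x X)) Y + S.g x (S.φ x X) Y =
            ∑ ν : Fin 3,
              (S.eta x (Jq ν) X * S.eta x (Jq ν) (S.φ x Y)
                - S.eta x (Jq ν) Y * S.eta x (Jq ν) (S.φ x X)
                - S.g x (S.phi x (Jq ν) X) Y * S.eta x (Jq ν) (S.reeb x)
                - 2 * S.η x X * S.eta x (Jq ν) (S.φ x Y) * S.eta x (Jq ν) (S.reeb x)
                + 2 * S.η x Y * S.eta x (Jq ν) (S.φ x X) * S.eta x (Jq ν) (S.reeb x)) :=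
  proposition2p1_general S hS
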